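/- **Setting.** Let $\mathbb G$ be a finite simple undirected graph on $n$ *rigid* agents. Attach $m$ *satellite* agents, each joined by a single edge to one rigid agent. Direct the edges arbitrarily, except that each satellite is the tail of its edge, and list the satellite edges last. Let $B$ be the incidence matrix of the resulting graph (entry $+1$ at the tail and $-1$ at the head of each edge), and write $\overline M=M\otimes I_2$. For positions $p\in\mathbb R^{2(n+m)}$ let $z=\overline B^Tp$ be the vector of relative positions $z_k\in\mathbb R^2$, let $D_z=\operatorname{diag}(z_1,\dots,z_{|\mathcal E|})$, and let $R(z)=D_z^T\overline B^T$ be the rigidity matrix. For prescribed distances $d_k>0$ let $e_k=\|z_k\|^2-d_k^2$. A formation of $n$ agents in the plane is infinitesimally rigid if its rigidity matrix has rank $2n-3$, and minimally so if moreover the removal of any one edge destroys this. Let $S$ be $B$ with all entries set to zero except the satellite (tail) entries of the satellite edges, and let $z^\perp$ be $z$ with every block $z_k$ turned clockwise by $\pi/2$. Let $p^*$ be a placement with $\|z_k(p^*)\|=d_k$ for all $k$ whose rigid agents form a minimally infinitesimally rigid formation. For a placement $q$, let $\mathcal A(q)$ be its *ambit*: the set of all relative-position vectors obtained from $z(q)$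 by rotating its blocks continuously, each by a rotation of its own, so that at all times they remain the relative positions of some placement (rotated copies of a shape are included). **Theorem 2 (satellites around rigid formations).** Consider the system $$\dot p=-R(z)^Te+\overline S z^\perp ,\qquad p(0)=p_0 .$$ 1. There are $\delta,C,r>0$ such that, whenever $\operatorname{dist}(z(p_0),\mathcal A(p^*))<\delta$, there is a solution on $[0,\infty)$, and every such solution satisfies $\|e(t)\|\le C\|e(0)\|e^{-rt}$ for all $t\ge 0$, and *(convergence to the ambit of $q=p^*$ at a point of its orbit)*: - $\operatorname{dist}(z(t),\mathcal A(q))\to0$ as $t\to\infty$; - there are $T\in SO(2)$ and $\tau\in\mathbb R^2$ such that every rigid agent $i$ satisfies $p_i(t)\to c_i:=Tq_i+\tau$ and $\dot p_i(t)\to0$; - every satellite $s$, with edge $k$ and rigid neighbour $a$, asymptotically rotates clockwise around it: for some $\theta$, $p_s(t)-\big(c_a+d_k(\cos(\theta-t),\sin(\theta-t))\big)\to0$, and $\dot z_k(t)-z_k^\perp(t)\to0$. 2. The ambit is stable, and so is the placement of the rigid agents: for every $\varepsilon>0$ there is $\delta>0$ such that $\operatorname{dist}(z(p_0),\mathcal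 A(p^*))<\delta$ implies, for every solution on $[0,\infty)$, $\operatorname{dist}(z(t),\mathcal A(p^*))<\varepsilon$ and $\|p_i(t)-p_i(0)\|<\varepsilon$ for all $t\ge0$ and all rigid agents $i$. 3. If every placement of the rigid agents that realizes the prescribed distances of their edges is infinitesimally rigid, then a small initial error suffices: there are $\delta,C,r>0$ such that, whenever $\|e(0)\|<\delta$, there is a solution on $[0,\infty)$, and for every such solution $\|e(t)\|\le C\|e(0)\|e^{-rt}$ for all $t\ge 0$ and there is a placement $q$ with $\|z_k(q)\|=d_k$ for all $k$ such that the solution converges to the ambit of $q$ at a point of its orbit, in the sense of the three bullets in 1. -/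

import Mathlib

open Filter Topology
open scoped Kronecker Matrix

/-- A finite simple undirected graph on the agents `V`, with its edges labelled by `E` and each
edge given an arbitrary direction. -/
structure OrientedGraph (V E : Type*) where
  tail : E → V
  head : E → V
  tail_ne_head : ∀ k, tail k ≠ head k
  simple : ∀ k k', s(tail k, head k) = s(tail k', head k') → k = k'

/-- A stacked vector in `ℝ^{2|ι|}`, with one planar block for each index. -/
abbrev Stacked (ι : Type*) : Type _ := EuclideanSpace ℝ (ι × Fin 2)

/-- The planar block of a stacked vector at an index. -/
def block {ι : Type*} (x : Stacked ι) (i : ι) : EuclideanSpace ℝ (Fin 2) :=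
  WithLp.toLp 2 fun c => x (i, c)

/-- A planar rotation (or any other matrix) applied to a planar vector. -/
noncomputable def rotate (T : Matrix (Fin 2) (Fin 2) ℝ) (v : EuclideanSpace ℝ (Fin 2)) :
    EuclideanSpace ℝ (Fin 2) :=
  WithLp.toLp 2 (T *ᵥ v.ofLp)

/-- A planar vector turned clockwise by `π / 2`. -/
noncomputable def cw (v : EuclideanSpace ℝ (Fin 2)) : EuclideanSpace ℝ (Fin 2) := !₂[v 1, -v 0]

/-- The stacked vector `z^⊥` of all blocks of `z` turned clockwise by `π / 2`. -/
noncomputable def perp {ι : Type*} (z : Stacked ι) : Stacked ι :=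
  WithLp.toLp 2 fun kc => cw (block z kc.1) kc.2

/-- The operator `D_z = diag(z_1, …, z_l)`, whose diagonal blocks are the columns `z_k`. -/
def blockDiag {ι : Type*} [DecidableEq ι] (z : Stacked ι) : Matrix (ι × Fin 2) ι ℝ :=
  fun kc k' => if kc.1 = k' then z kc else 0

/-- Every block of `z` rotated by a matrix of its own. -/
noncomputable def rotateBlocks {ι : Type*}
    (T : ι → Matrix.specialOrthogonalGroup (Fin 2) ℝ) (z : Stacked ι) : Stacked ι :=
  WithLp.toLp 2 fun kc => rotate (T kc.1 : Matrix (Fin 2) (Fin 2) ℝ) (block z kc.1) kc.2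

/-- The vector of distance errors, `e_k = ‖z_k‖² - d_k²`. -/
noncomputable def distErr {E : Type*} (d : E → ℝ) (z : Stacked E) : EuclideanSpace ℝ E :=
  WithLp.toLp 2 fun k => ‖block z k‖ ^ 2 - d k ^ 2

namespace OrientedGraph

variable {V E : Type*}

/-- The incidence matrix `B`. -/
def incidence [DecidableEq V] (G : OrientedGraph V E) : Matrix V E ℝ :=
  fun i k => if i = G.tail k then 1 else if i = G.head k then -1 else 0

/-- The Kronecker product `M ⊗ I₂`. -/
def bar (M : Matrix V E ℝ) : Matrix (V × Fin 2) (E × Fin 2) ℝ :=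
  M ⊗ₖ (1 : Matrix (Fin 2) (Fin 2) ℝ)

/-- The stacked vector of relative positions `z = (B ⊗ I₂)ᵀ p`. -/
noncomputable def relPos [Fintype V] [DecidableEq V] (G : OrientedGraph V E) (p : Stacked V) :
    Stacked E :=
  WithLp.toLp 2 ((bar G.incidence)ᵀ *ᵥ p.ofLp)

/-- The rigidity matrix `R(z) = D_zᵀ (B ⊗ I₂)ᵀ`. -/
def rigidityMatrix [Fintype E] [DecidableEq V] [DecidableEq E] (G : OrientedGraph V E)
    (z : Stacked E) : Matrix E (V × Fin 2) ℝ :=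
  (blockDiag z)ᵀ * (bar G.incidence)ᵀ

/-- The formation `(G, p)` is infinitesimally rigid in the plane: `rank R = 2 |V| - 3`. -/
def InfRigid [Fintype V] [Fintype E] [DecidableEq V] [DecidableEq E] (G : OrientedGraph V E)
    (p : Stacked V) : Prop :=
  (G.rigidityMatrix (G.relPos p)).rank + 3 = 2 * Fintype.card V

/-- The graph with the edge `k` removed. -/
def removeEdge (G : OrientedGraph V E) (k : E) : OrientedGraph V {k' : E // k' ≠ k} where
  tail j := G.tail j
  head j := G.head j
  tail_ne_head j := G.tail_ne_head j
  simple j j' h := Subtype.ext (G.simple j j' h)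

/-- The formation is infinitesimally rigid, and the removal of any one edge destroys this. -/
def MinInfRigid [Fintype V] [Fintype E] [DecidableEq V] [DecidableEq E] (G : OrientedGraph V E)
    (p : Stacked V) : Prop :=
  G.InfRigid p ∧ ∀ k : E, ¬ (G.removeEdge k).InfRigid p

/-- The ambit of the formation `(G, p)`: all the vectors of relative positions that arise from
`z = (B ⊗ I₂)ᵀ p` when the `z_k` are rotated continuously, each by a rotation of its own, in such
a way that they remain the relative positions of some placement of the agents (so that the agents
move and all the edge lengths stay constant). A rotation of the formation as a whole does not
change its shape; rotated copies are kept in this set, which is thus the ambit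
together with the rotations of all its shapes. -/
def ambit [Fintype V] [DecidableEq V] (G : OrientedGraph V E) (p : Stacked V) :
    Set (Stacked E) :=
  {z' | ∃ T : unitInterval → E → Matrix.specialOrthogonalGroup (Fin 2) ℝ,
    Continuous T ∧ T 0 = 1 ∧
    (∀ s, rotateBlocks (T s) (G.relPos p) ∈ Set.range G.relPos) ∧
    z' = rotateBlocks (T 1) (G.relPos p)}

section Satellites

variable {W : Type*}

/-- The graph `G` of the rigid agents with a satellite agent for each element of `W`; satellite `s`
is linked by a single edge, of which it is the tail, with the rigid agent `a s`. -/
def withSatellites (G : OrientedGraph V E) (a : W → V) : OrientedGraph (V ⊕ W) (E ⊕ W) where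
  tail := Sum.elim (fun k => Sum.inl (G.tail k)) Sum.inr
  head := Sum.elim (fun k => Sum.inl (G.head k)) (fun s => Sum.inl (a s))
  tail_ne_head := by
    rintro (k | s)
    · simpa using G.tail_ne_head k
    · simp
  simple := by
    rintro (k | s) (k' | s') h
    · have h' : s(G.tail k, G.head k) = s(G.tail k', G.head k') := by simpa using h
      rw [G.simple k k' h']
    · simp at h
    · simp at h
    · have h' : s = s' := by
        have := h
        simp at this
        exact this.1
      rw [h']

/-- The part of a stacked vector that belongs to the rigid agents. -/
def rigidPart (p : Stacked (V ⊕ W)) : Stacked V := WithLp.toLp 2 fun ic => p (Sum.inl ic.1, ic.2)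

/-- The matrix `S`: the incidence matrix `B` with all its entries set to zero except those of the
tails (the satellites) of the edges in which a satellite is involved. -/
def satelliteMatrix [DecidableEq V] [DecidableEq W] (G : OrientedGraph V E) (a : W → V) :
    Matrix (V ⊕ W) (E ⊕ W) ℝ :=
  fun i k => Sum.elim (fun _ => 0)
    (fun s => if i = (G.withSatellites a).tail (Sum.inr s)
      then (G.withSatellites a).incidence i (Sum.inr s) else 0) k

variable [Fintype V] [Fintype E] [Fintype W] [DecidableEq V] [DecidableEq E] [DecidableEq W]

/-- The closed-loop vector field `p ↦ -R(z)ᵀ e + (S ⊗ I₂) z^⊥`. -/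
noncomputable def closedLoop (G : OrientedGraph V E) (a : W → V) (d : E ⊕ W → ℝ)
    (p : Stacked (V ⊕ W)) : Stacked (V ⊕ W) :=
  let z := (G.withSatellites a).relPos p
  WithLp.toLp 2 (-(((G.withSatellites a).rigidityMatrix z)ᵀ *ᵥ (distErr d z).ofLp)
    + bar (G.satelliteMatrix a) *ᵥ (perp z).ofLp)

/-- `p` solves `ṗ = -R(z)ᵀ e + (S ⊗ I₂) z^⊥` on `[0, ∞)` with initial value `p₀`. -/
def IsSolution (G : OrientedGraph V E) (a : W → V) (d : E ⊕ W → ℝ)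
    (p₀ : Stacked (V ⊕ W)) (p : ℝ → Stacked (V ⊕ W)) : Prop :=
  p 0 = p₀ ∧ ∀ t ∈ Set.Ici (0 : ℝ), HasDerivWithinAt p (G.closedLoop a d (p t)) (Set.Ici 0) t

/-- The distance errors along `p` decay exponentially, with constant `C` and rate `r`. -/
def ErrorsDecay (G : OrientedGraph V E) (a : W → V) (d : E ⊕ W → ℝ) (C r : ℝ)
    (p : ℝ → Stacked (V ⊕ W)) : Prop :=
  ∀ t, 0 ≤ t → ‖distErr d ((G.withSatellites a).relPos (p t))‖ ≤
    C * ‖distErr d ((G.withSatellites a).relPos (p 0))‖ * Real.exp (-(r * t))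

/-- The motion `p` converges to the ambit of the formation placed at `q`, at a point of its orbit:
the relative positions approach the ambit; the rigid agents come to a stop at a rotated and
translated copy of their placement in `q`; and each satellite approaches a uniform clockwise
rotation with unit angular velocity, at distance `d_s`, around the final position of its
neighbour. -/
def ConvergesToAmbit (G : OrientedGraph V E) (a : W → V) (d : E ⊕ W → ℝ)
    (q : Stacked (V ⊕ W)) (p : ℝ → Stacked (V ⊕ W)) : Prop :=
  Tendsto (fun t => Metric.infDist ((G.withSatellites a).relPos (p t))
    ((G.withSatellites a).ambit q)) atTop (𝓝 0) ∧
  ∃ (T : Matrix.specialOrthogonalGroup (Fin 2) ℝ) (τ : EuclideanSpace ℝ (Fin 2)),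
    let c : V → EuclideanSpace ℝ (Fin 2) :=
      fun i => rotate (T : Matrix (Fin 2) (Fin 2) ℝ) (block q (Sum.inl i)) + τ
    (∀ i : V,
      Tendsto (fun t => block (p t) (Sum.inl i)) atTop (𝓝 (c i)) ∧
      Tendsto (fun t => deriv (fun u => block (p u) (Sum.inl i)) t) atTop (𝓝 0)) ∧
    (∀ s : W,
      (∃ θ : ℝ, Tendsto (fun t => block (p t) (Sum.inr s) -
        (c (a s) + d (Sum.inr s) • !₂[Real.cos (θ - t), Real.sin (θ - t)])) atTop (𝓝 0)) ∧
      Tendsto (fun t =>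
        deriv (fun u => block ((G.withSatellites a).relPos (p u)) (Sum.inr s)) t -
          cw (block ((G.withSatellites a).relPos (p t)) (Sum.inr s))) atTop (𝓝 0))

end Satellites

end OrientedGraph

set_option linter.unusedSectionVars false

/-! ### Auxiliary facts of analysis -/

/-! The spin does not affect the decay of the errors. It acts only on satellites, where the error
force $R(z)^Te$ is parallel to $z_s$ and the spin is perpendicular to it, so the two are orthogonal
(`inner_force_closedLoop`) and $\frac{d}{dt}\|e\|^2=-4\|R(z)^Te\|^2$. Where the rows of $R(z)$ are
independent, compactness gives $\|R(z)^Te\|\ge\lambda\|e\|$ uniformly nearby, hence exponential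
decay. The rigid agents move with velocity $-R(z)^Te$, so their total displacement is at most a
constant times $\|e(0)\|$, and the motion never leaves the region where $\lambda$ is valid.
`exists_trapping` closes this circle; it yields stability and, through a cut-off field, global
existence.

Minimality gives $|E|=2n-3$, so that independent rows and infinitesimal rigidity are the same
condition. The limit of the rigid agents is identified by local uniqueness: if two placements have
equal edge lengths, their difference is an infinitesimal motion of their midpoint, hence trivial
when the midpoint has independent rows, and the placements are congruent
(`exists_rotate_of_indepAt_midpoint`). The same fact, with a clopen argument along a path, shows
that the ambit is the rotation orbit of the rigid shape times one full circle per satellite.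

In a frame turning clockwise at unit speed a satellite's relative position has exponentially small
velocity, so it converges and has an asymptotic phase (`exists_phase`).

All estimates are made near a compact set $K$ of rigid shapes with independent rows. For the ambit
of $p^*$, $K$ is the rotation orbit of its rigid shape; for the last claim it is the set of all
realizations of the distances. -/

theorem forall_lt_of_bootstrap {g : ℝ → ℝ} {b : ℝ} (hg : ContinuousOn g (Set.Ici 0))
    (h : ∀ T, 0 ≤ T → (∀ t ∈ Set.Ico 0 T, g t < b) → g T < b) : ∀ t, 0 ≤ t → g t < b := by
  by_contra! hcon
  obtain ⟨t₁, ht₁, hb⟩ := hcon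
  have hcomp : IsCompact (Set.Icc 0 t₁ ∩ g ⁻¹' Set.Ici b) :=
    isCompact_Icc.of_isClosed_subset
      ((hg.mono Set.Icc_subset_Ici_self).preimage_isClosed_of_isClosed isClosed_Icc isClosed_Ici)
      Set.inter_subset_left
  -- The earliest time with `g ≥ b` contradicts `h` at that time. At `T = 0` the premise of `h` is
  -- vacuous, so `h` also covers the initial value.
  obtain ⟨τ, ⟨⟨hτ0, hτ1⟩, hτb⟩, hmin⟩ := hcomp.exists_isLeast ⟨t₁, ⟨ht₁, le_rfl⟩, hb⟩
  refine absurd (h τ hτ0 fun t ht => ?_) (not_lt.2 hτb)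
  by_contra! hc
  exact absurd (hmin ⟨⟨ht.1, ht.2.le.trans hτ1⟩, hc⟩) (not_le.2 ht.2)

/-! ### Global solutions for bounded Lipschitz vector fields -/

section GlobalSolution

variable {F : Type*} [NormedAddCommGroup F] [NormedSpace ℝ F] [CompleteSpace F]

theorem exists_solution_Icc_of_lipschitzWith {f : F → F} {K : NNReal} (hf : LipschitzWith K f)
    {L : NNReal} (hL : ∀ x, ‖f x‖ ≤ L) (x₀ : F) (n : ℕ) :
    ∃ α : ℝ → F, α 0 = x₀ ∧
      ∀ t ∈ Set.Icc (0 : ℝ) n, HasDerivWithinAt α (f (α t)) (Set.Icc 0 (n : ℝ)) t := by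
  -- Speed at most `L` keeps the solution within `L * n` of `x₀` up to time `n`. As the bounds are
  -- global, the interval may be as long as desired.
  have hP : IsPicardLindelof (fun _ : ℝ => f) (tmin := 0) (tmax := n)
      ⟨0, le_rfl, Nat.cast_nonneg n⟩ x₀ (L * n) 0 L K :=
    { lipschitzOnWith := fun t _ => hf.lipschitzOnWith
      continuousOn := fun x _ => continuousOn_const
      norm_le := fun t _ x _ => hL x
      mul_max_le := by simp }
  exact hP.exists_eq_forall_mem_Icc_hasDerivWithinAt₀

theorem exists_solution_Ici_of_lipschitzWith {f : F → F} {K : NNReal} (hf : LipschitzWith K f)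
    {L : NNReal} (hL : ∀ x, ‖f x‖ ≤ L) (x₀ : F) :
    ∃ α : ℝ → F, α 0 = x₀ ∧
      ∀ t ∈ Set.Ici (0 : ℝ), HasDerivWithinAt α (f (α t)) (Set.Ici 0) t := by
  choose α hα0 hα using exists_solution_Icc_of_lipschitzWith hf hL x₀
  have hIci : ∀ n : ℕ, ∀ t ∈ Set.Ico (0 : ℝ) n,
      HasDerivWithinAt (α n) (f (α n t)) (Set.Ici t) t := fun n t ht =>
    (hα n t ⟨ht.1, ht.2.le⟩).mono_of_mem_nhdsWithin (by
      filter_upwards [Ico_mem_nhdsGE ht.2] with u hu using ⟨ht.1.trans hu.1, hu.2.le⟩)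
  have heq : ∀ {m n : ℕ}, m ≤ n → Set.EqOn (α m) (α n) (Set.Icc 0 m) := by
    intro m n hmn
    have hmn' : (m : ℝ) ≤ n := by exact_mod_cast hmn
    refine ODE_solution_unique (v := fun _ => f) (fun _ => hf)
      (fun t ht => (hα m t ht).continuousWithinAt) (hIci m) ?_ ?_ (by rw [hα0, hα0])
    · exact fun t ht => ((hα n t ⟨ht.1, ht.2.trans hmn'⟩).continuousWithinAt).mono
        (Set.Icc_subset_Icc_right hmn')
    · exact fun t ht => hIci n t ⟨ht.1, ht.2.trans_le hmn'⟩
  have hval : ∀ (n : ℕ) (t : ℝ), 0 ≤ t → t ≤ n → α ⌈t⌉₊ t = α n t := fun n t h0 ht =>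
    heq (Nat.ceil_le.2 ht) ⟨h0, Nat.le_ceil t⟩
  -- The solutions on `[0, n]` agree by uniqueness, so they may be glued by reading off any one
  -- whose interval contains `t`.
  refine ⟨fun t => α ⌈t⌉₊ t, by simp [hα0], fun t ht => ?_⟩
  have ht : (0 : ℝ) ≤ t := ht
  -- The extra `1` puts `t` strictly before the end of the interval even when `t` is an integer, as
  -- the derivative within `[0, ∞)` requires.
  set n := ⌈t⌉₊ + 1 with hn
  have htn : t < n := by
    have := Nat.le_ceil t
    push_cast [hn]
    linarith
  have hnhds : Set.Icc (0 : ℝ) n ∈ 𝓝[Set.Ici 0] t := by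
    filter_upwards [self_mem_nhdsWithin, mem_nhdsWithin_of_mem_nhds (Iio_mem_nhds htn)]
      with u hu hu' using ⟨hu, hu'.le⟩
  have hd := (hα n t ⟨ht, htn.le⟩).mono_of_mem_nhdsWithin hnhds
  change HasDerivWithinAt _ (f (α ⌈t⌉₊ t)) _ _
  rw [hval n t ht htn.le]
  refine hd.congr_of_eventuallyEq ?_ (hval n t ht htn.le)
  filter_upwards [hnhds] with u hu using hval n u hu.1 hu.2

end GlobalSolution

/-! ### Exponential estimates -/

section ExponentialBounds

variable {F : Type*} [NormedAddCommGroup F] [NormedSpace ℝ F]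

/-- The bound is the integral of the speed limit over `[s, ∞)`, so it does not depend on `T`. -/
theorem norm_sub_le_of_norm_deriv_le_exp {f f' : ℝ → F} {A r s T : ℝ} (hr : 0 < r) (hA : 0 ≤ A)
    (hsT : s ≤ T) (hf : ContinuousOn f (Set.Icc s T))
    (hf' : ∀ t ∈ Set.Ico s T, HasDerivWithinAt f (f' t) (Set.Ici t) t)
    (hb : ∀ t ∈ Set.Ico s T, ‖f' t‖ ≤ A * Real.exp (-(r * t))) :
    ‖f T - f s‖ ≤ A / r * Real.exp (-(r * s)) := by
  have hB : ∀ t, HasDerivAt (fun t => A / r * (Real.exp (-(r * s)) - Real.exp (-(r * t))))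
      (A * Real.exp (-(r * t))) t := by
    intro t
    have h1 : HasDerivAt (fun t => Real.exp (-(r * t))) (Real.exp (-(r * t)) * (-(r * 1))) t :=
      ((hasDerivAt_id t).const_mul r).neg.exp
    have h2 := (h1.const_sub (Real.exp (-(r * s)))).const_mul (A / r)
    exact h2.congr_deriv (by field_simp)
  have := image_norm_le_of_norm_deriv_right_le_deriv_boundary (f := fun t => f t - f s)
    (hf.sub continuousOn_const) (fun t ht => (hf' t ht).sub_const (f s)) (by simp) hB hb
    (Set.right_mem_Icc.2 hsT)
  refine this.trans (mul_le_mul_of_nonneg_left ?_ (by positivity))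
  have := Real.exp_pos (-(r * T))
  linarith

theorem exists_tendsto_of_norm_deriv_le_exp [CompleteSpace F] {f f' : ℝ → F} {A r : ℝ}
    (hr : 0 < r) (hA : 0 ≤ A)
    (hf' : ∀ t, 0 ≤ t → HasDerivWithinAt f (f' t) (Set.Ici 0) t)
    (hb : ∀ t, 0 ≤ t → ‖f' t‖ ≤ A * Real.exp (-(r * t))) :
    ∃ x, Tendsto f atTop (𝓝 x) := by
  have key : ∀ s T, 0 ≤ s → s ≤ T → ‖f T - f s‖ ≤ A / r * Real.exp (-(r * s)) := by
    intro s T hs hsT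
    refine norm_sub_le_of_norm_deriv_le_exp (f' := f') hr hA hsT ?_ ?_ ?_
    · exact fun t ht => ((hf' t (hs.trans ht.1)).continuousWithinAt).mono
        fun u hu => hs.trans hu.1
    · exact fun t ht => (hf' t (hs.trans ht.1)).mono fun u hu => (hs.trans ht.1).trans hu
    · exact fun t ht => hb t (hs.trans ht.1)
  have hlim : Tendsto (fun s => A / r * Real.exp (-(r * s))) atTop (𝓝 0) := by
    have : Tendsto (fun s => Real.exp (-(r * s))) atTop (𝓝 0) :=
      Real.tendsto_exp_neg_atTop_nhds_zero.comp (tendsto_id.const_mul_atTop hr)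
    simpa using this.const_mul (A / r)
  refine cauchySeq_tendsto_of_complete (Metric.cauchySeq_iff'.2 fun ε hε => ?_)
  obtain ⟨s, hs0, hs⟩ := ((eventually_ge_atTop (0 : ℝ)).and (hlim.eventually_lt_const hε)).exists
  exact ⟨s, fun t ht => by
    rw [dist_eq_norm]
    exact (key s t hs0 ht).trans_lt hs⟩

/-- The product `f t * exp (c * t)` is nonincreasing. -/
theorem le_mul_exp_of_deriv_le {f f' : ℝ → ℝ} {c T : ℝ} (hT : 0 ≤ T)
    (hf : ContinuousOn f (Set.Icc 0 T))
    (hf' : ∀ t ∈ Set.Ico 0 T, HasDerivWithinAt f (f' t) (Set.Ici t) t)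
    (hb : ∀ t ∈ Set.Ico 0 T, f' t ≤ -(c * f t)) :
    f T ≤ f 0 * Real.exp (-(c * T)) := by
  have hexp : ∀ t, HasDerivAt (fun t => Real.exp (c * t)) (Real.exp (c * t) * (c * 1)) t :=
    fun t => ((hasDerivAt_id t).const_mul c).exp
  have := image_le_of_deriv_right_le_deriv_boundary (f := fun t => f t * Real.exp (c * t))
    (f' := fun t => f' t * Real.exp (c * t) + f t * (Real.exp (c * t) * (c * 1)))
    (B := fun _ => f 0) (B' := fun _ => 0) (a := 0) (b := T)
    (hf.mul (by fun_prop)) (fun t ht => (hf' t ht).mul (hexp t).hasDerivWithinAt) (by simp)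
    continuousOn_const (fun t _ => hasDerivWithinAt_const _ _ _) (fun t ht => by
      have h1 := hb t ht
      have h2 := Real.exp_pos (c * t)
      nlinarith) (Set.right_mem_Icc.2 hT)
  rw [Real.exp_neg, ← div_eq_mul_inv, le_div_iff₀ (Real.exp_pos _)]
  exact this

end ExponentialBounds

/-! ### Uniform bounds from compactness -/

section Compactness

/-- On the compact set `{h ≤ 1} \ U` the function `h` has a positive minimum; half of it serves as
`b`. -/
theorem exists_sublevel_subset {Z : Type*} [TopologicalSpace Z] {h : Z → ℝ} (hc : Continuous h)
    (hcomp : IsCompact {z | h z ≤ 1}) {U : Set Z} (hU : IsOpen U) (hsub : {z | h z ≤ 0} ⊆ U) :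
    ∃ b, 0 < b ∧ b ≤ 1 ∧ {z | h z ≤ b} ⊆ U := by
  rcases ({z | h z ≤ 1} \ U).eq_empty_or_nonempty with hem | hne
  · exact ⟨1, one_pos, le_rfl, Set.sdiff_eq_empty.1 hem⟩
  · obtain ⟨z₀, hz₀, hmin⟩ := (hcomp.diff hU).exists_isMinOn hne hc.continuousOn
    have hpos : 0 < h z₀ := by
      by_contra! hle
      exact hz₀.2 (hsub hle)
    refine ⟨h z₀ / 2, by linarith, by linarith [show h z₀ ≤ 1 from hz₀.1], fun z hz => ?_⟩
    by_contra hzU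
    have hz : h z ≤ h z₀ / 2 := hz
    have : h z₀ ≤ h z := hmin ⟨show h z ≤ 1 by linarith [show h z₀ ≤ 1 from hz₀.1], hzU⟩
    linarith

/-- Meant for `F z x = R(z)ᵀ x` with `h` a distance-like function. By the tube lemma `F` has no zero
on a neighbourhood of `{h ≤ 0}` times the unit sphere; its minimum there is `lam`, and homogeneity
extends the bound to all `x`. -/
theorem exists_lower_bound_of_injective {Z X Y : Type*} [TopologicalSpace Z]
    [NormedAddCommGroup X] [NormedSpace ℝ X] [FiniteDimensional ℝ X]
    [NormedAddCommGroup Y] [NormedSpace ℝ Y] {h : Z → ℝ} (hc : Continuous h)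
    (hcomp : IsCompact {z | h z ≤ 1}) {F : Z → X → Y} (hF : Continuous fun q : Z × X => F q.1 q.2)
    (hsmul : ∀ z (c : ℝ) x, F z (c • x) = c • F z x)
    (hinj : ∀ z, h z ≤ 0 → ∀ x, F z x = 0 → x = 0) :
    ∃ b, 0 < b ∧ b ≤ 1 ∧ ∃ lam, 0 < lam ∧ ∀ z, h z ≤ b → ∀ x, lam * ‖x‖ ≤ ‖F z x‖ := by
  have := FiniteDimensional.proper_real X
  have hS : IsCompact (Metric.sphere (0 : X) 1) := isCompact_sphere 0 1
  have h0 : IsCompact {z | h z ≤ 0} := hcomp.of_isClosed_subset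
    (isClosed_le hc continuous_const) fun z (hz : h z ≤ 0) => hz.trans zero_le_one
  obtain ⟨u, v, hu, -, h0u, hSv, huv⟩ := generalized_tube_lemma h0 hS
    (n := {q : Z × X | F q.1 q.2 ≠ 0}) (isOpen_ne_fun hF continuous_const)
    (fun q hq hq0 => by
      have := hinj q.1 hq.1 q.2 hq0
      have h1 : ‖q.2‖ = 1 := by simpa using hq.2
      rw [this] at h1
      simp at h1)
  obtain ⟨b, hb, hb1, hbu⟩ := exists_sublevel_subset hc hcomp hu h0u
  refine ⟨b, hb, hb1, ?_⟩
  have hBc : IsCompact {z | h z ≤ b} := hcomp.of_isClosed_subset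
    (isClosed_le hc continuous_const) fun z (hz : h z ≤ b) => hz.trans hb1
  rcases ({z | h z ≤ b} ×ˢ Metric.sphere (0 : X) 1).eq_empty_or_nonempty with hem | hne
  · refine ⟨1, one_pos, fun z hz x => ?_⟩
    by_cases hx : x = 0
    · simp [hx]
    · have hmem : (z, ‖x‖⁻¹ • x) ∈ {z | h z ≤ b} ×ˢ Metric.sphere (0 : X) 1 :=
        ⟨hz, by simp [norm_smul, hx]⟩
      rw [hem] at hmem
      exact hmem.elim
  · obtain ⟨q₀, hq₀, hmin⟩ := (hBc.prod hS).exists_isMinOn hne hF.norm.continuousOn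
    have hpos : F q₀.1 q₀.2 ≠ 0 := huv ⟨hbu hq₀.1, hSv hq₀.2⟩
    refine ⟨‖F q₀.1 q₀.2‖, norm_pos_iff.2 hpos, fun z hz x => ?_⟩
    by_cases hx : x = 0
    · simp [hx]
    · have hx' : 0 < ‖x‖ := norm_pos_iff.2 hx
      have hmem : (z, ‖x‖⁻¹ • x) ∈ {z | h z ≤ b} ×ˢ Metric.sphere (0 : X) 1 :=
        ⟨hz, by simp [norm_smul, hx]⟩
      have : ‖F q₀.1 q₀.2‖ ≤ ‖F z (‖x‖⁻¹ • x)‖ := hmin hmem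
      rw [hsmul, norm_smul, norm_inv, norm_norm, inv_mul_eq_div, le_div_iff₀ hx'] at this
      exact this

end Compactness

theorem exists_upper_bound_of_homogeneous {Z X Y : Type*} [TopologicalSpace Z]
    [NormedAddCommGroup X] [NormedSpace ℝ X] [FiniteDimensional ℝ X]
    [NormedAddCommGroup Y] [NormedSpace ℝ Y] {S : Set Z} (hS : IsCompact S)
    {F : Z → X → Y} (hF : Continuous fun q : Z × X => F q.1 q.2)
    (hsmul : ∀ z (c : ℝ) x, F z (c • x) = c • F z x) :
    ∃ M, 0 < M ∧ ∀ z ∈ S, ∀ x, ‖F z x‖ ≤ M * ‖x‖ := by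
  have := FiniteDimensional.proper_real X
  obtain ⟨M, hM⟩ := (hS.prod (isCompact_closedBall (0 : X) 1)).exists_bound_of_continuousOn
    hF.continuousOn
  refine ⟨max M 1, by positivity, fun z hz x => ?_⟩
  by_cases hx : x = 0
  · have := hsmul z 0 x
    rw [zero_smul, zero_smul] at this
    simp [hx, this]
  · have hx' : 0 < ‖x‖ := norm_pos_iff.2 hx
    have := (hM (z, ‖x‖⁻¹ • x) ⟨hz, by simp [norm_smul, hx]⟩).trans (le_max_left M 1)
    rw [hsmul, norm_smul, norm_inv, norm_norm, inv_mul_eq_div, div_le_iff₀ hx'] at this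
    exact this

theorem LinearMap.comp_hasDerivWithinAt {F F' : Type*} [NormedAddCommGroup F] [NormedSpace ℝ F]
    [FiniteDimensional ℝ F] [NormedAddCommGroup F'] [NormedSpace ℝ F'] (l : F →ₗ[ℝ] F')
    {f : ℝ → F} {f' : F} {s : Set ℝ} {t : ℝ} (h : HasDerivWithinAt f f' s t) :
    HasDerivWithinAt (fun u => l (f u)) (l f') s t :=
  l.toContinuousLinearMap.hasFDerivAt.comp_hasDerivWithinAt t h

/-! ### Blocks and components -/

section Blocks

variable {ι : Type*}

@[simp] theorem block_apply (x : Stacked ι) (i : ι) (c : Fin 2) : block x i c = x (i, c) := rfl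

theorem stacked_ext {x y : Stacked ι} (h : ∀ i, block x i = block y i) : x = y := by
  ext ⟨i, c⟩
  rw [← block_apply, h, block_apply]

/-- The block at an index, as a linear map. -/
def blockₗ (i : ι) : Stacked ι →ₗ[ℝ] EuclideanSpace ℝ (Fin 2) where
  toFun x := block x i
  map_add' _ _ := rfl
  map_smul' _ _ := rfl

theorem block_add (x y : Stacked ι) (i : ι) : block (x + y) i = block x i + block y i := rfl

theorem block_sub (x y : Stacked ι) (i : ι) : block (x - y) i = block x i - block y i := rfl

theorem block_smul (c : ℝ) (x : Stacked ι) (i : ι) : block (c • x) i = c • block x i := rfl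

variable [Fintype ι]

theorem norm_sq_eq_sum_block (x : Stacked ι) : ‖x‖ ^ 2 = ∑ i, ‖block x i‖ ^ 2 := by
  simp [EuclideanSpace.norm_sq_eq, Fintype.sum_prod_type]

theorem inner_eq_sum_block (x y : Stacked ι) :
    inner ℝ x y = ∑ i, inner ℝ (block x i) (block y i) := by
  simp [PiLp.inner_apply, Fintype.sum_prod_type]

theorem norm_block_le (x : Stacked ι) (i : ι) : ‖block x i‖ ≤ ‖x‖ := by
  refine (pow_le_pow_iff_left₀ (norm_nonneg _) (norm_nonneg _) two_ne_zero).1 ?_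
  rw [norm_sq_eq_sum_block]
  exact Finset.single_le_sum (f := fun i => ‖block x i‖ ^ 2) (fun _ _ => by positivity)
    (Finset.mem_univ i)

theorem norm_le_sum_block (x : Stacked ι) : ‖x‖ ≤ ∑ i, ‖block x i‖ := by
  refine (pow_le_pow_iff_left₀ (norm_nonneg _) (Finset.sum_nonneg fun _ _ => norm_nonneg _)
    two_ne_zero).1 ?_
  rw [norm_sq_eq_sum_block]
  exact Finset.sum_sq_le_sq_sum_of_nonneg fun i _ => norm_nonneg _

theorem continuous_block (i : ι) : Continuous fun x : Stacked ι => block x i :=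
  (blockₗ i).continuous_of_finiteDimensional

theorem continuous_stacked {X : Type*} [TopologicalSpace X] {f : X → Stacked ι}
    (h : ∀ i, Continuous fun x => block (f x) i) : Continuous f := by
  refine (PiLp.continuous_toLp 2 _).comp (continuous_pi fun ic => ?_)
  exact ((EuclideanSpace.proj (𝕜 := ℝ) ic.2).continuous).comp (h ic.1)

end Blocks

theorem cw_apply_zero (v : EuclideanSpace ℝ (Fin 2)) : cw v 0 = v 1 := rfl

theorem cw_apply_one (v : EuclideanSpace ℝ (Fin 2)) : cw v 1 = -v 0 := rfl

theorem inner_fin_two (v w : EuclideanSpace ℝ (Fin 2)) : inner ℝ v w = v 0 * w 0 + v 1 * w 1 := by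
  simp [PiLp.inner_apply, Fin.sum_univ_two]; ring

theorem inner_cw_self (v : EuclideanSpace ℝ (Fin 2)) : inner ℝ v (cw v) = 0 := by
  rw [inner_fin_two, cw_apply_zero, cw_apply_one]; ring

theorem block_perp {ι : Type*} (z : Stacked ι) (k : ι) : block (perp z) k = cw (block z k) := rfl

/-! ### Relative positions, the rigidity matrix and the closed loop in blocks -/

namespace OrientedGraph

variable {V E W : Type*}

theorem incidence_eq [DecidableEq V] (G : OrientedGraph V E) (i : V) (k : E) :
    G.incidence i k = (if i = G.tail k then 1 else 0) - (if i = G.head k then 1 else 0) := by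
  have := G.tail_ne_head k
  unfold incidence
  split_ifs with h1 h2 <;> simp_all

theorem sum_incidence_smul [Fintype V] [DecidableEq V] {F : Type*} [AddCommGroup F] [Module ℝ F]
    (G : OrientedGraph V E) (v : V → F) (k : E) :
    ∑ i, G.incidence i k • v i = v (G.tail k) - v (G.head k) := by
  simp [incidence_eq, sub_smul, ite_smul, Finset.sum_sub_distrib]

theorem block_relPos [Fintype V] [DecidableEq V] (G : OrientedGraph V E) (p : Stacked V) (k : E) :
    block (G.relPos p) k = block p (G.tail k) - block p (G.head k) := by
  ext c
  rw [← G.sum_incidence_smul (fun i => block p i) k]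
  simp [relPos, bar, Matrix.mulVec, dotProduct, Matrix.one_apply,
    Fintype.sum_prod_type, Matrix.kroneckerMap_apply]

/-- The vector of relative positions, as a linear function of the placement. -/
noncomputable def relPosₗ [Fintype V] [DecidableEq V] (G : OrientedGraph V E) :
    Stacked V →ₗ[ℝ] Stacked E where
  toFun := G.relPos
  map_add' p q := stacked_ext fun k => by simp only [block_relPos, block_add]; abel
  map_smul' c p := stacked_ext fun k => by
    simp only [block_relPos, block_smul, RingHom.id_apply, smul_sub]

theorem relPos_add [Fintype V] [DecidableEq V] (G : OrientedGraph V E) (p q : Stacked V) :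
    G.relPos (p + q) = G.relPos p + G.relPos q := G.relPosₗ.map_add p q

theorem relPos_sub [Fintype V] [DecidableEq V] (G : OrientedGraph V E) (p q : Stacked V) :
    G.relPos (p - q) = G.relPos p - G.relPos q := G.relPosₗ.map_sub p q

theorem relPos_smul [Fintype V] [DecidableEq V] (G : OrientedGraph V E) (c : ℝ) (p : Stacked V) :
    G.relPos (c • p) = c • G.relPos p := G.relPosₗ.map_smul c p

theorem continuous_relPos [Fintype V] [DecidableEq V] [Fintype E] (G : OrientedGraph V E) :
    Continuous G.relPos := G.relPosₗ.continuous_of_finiteDimensional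

section Rigidity

variable [Fintype V] [Fintype E] [DecidableEq V] [DecidableEq E]

theorem rigidityMatrix_apply (G : OrientedGraph V E) (z : Stacked E) (k : E) (i : V) (c : Fin 2) :
    G.rigidityMatrix z k (i, c) = G.incidence i k * z (k, c) := by
  simp [rigidityMatrix, Matrix.mul_apply, blockDiag, bar, Matrix.one_apply,
    Fintype.sum_prod_type, Matrix.kroneckerMap_apply, mul_comm]

/-- The stacked vector `R(z)ᵀ x`. -/
noncomputable def force (G : OrientedGraph V E) (z : Stacked E) (x : EuclideanSpace ℝ E) :
    Stacked V :=
  WithLp.toLp 2 ((G.rigidityMatrix z)ᵀ *ᵥ x.ofLp)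

theorem block_force (G : OrientedGraph V E) (z : Stacked E) (x : EuclideanSpace ℝ E) (i : V) :
    block (G.force z x) i = ∑ k, (G.incidence i k * x k) • block z k := by
  ext c
  simp only [block_apply, force, Matrix.mulVec, dotProduct, Matrix.transpose_apply,
    rigidityMatrix_apply, WithLp.ofLp_sum, Finset.sum_apply, PiLp.smul_apply, smul_eq_mul]
  exact Finset.sum_congr rfl fun k _ => by ring

theorem rigidityMatrix_mulVec (G : OrientedGraph V E) (z : Stacked E) (v : Stacked V) (k : E) :
    (G.rigidityMatrix z *ᵥ v.ofLp) k = inner ℝ (block z k) (block (G.relPos v) k) := by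
  rw [block_relPos, ← G.sum_incidence_smul (fun i => block v i), inner_sum]
  simp only [Matrix.mulVec, dotProduct, rigidityMatrix_apply, Fintype.sum_prod_type,
    Fin.sum_univ_two, inner_smul_right, inner_fin_two, block_apply]
  exact Finset.sum_congr rfl fun i _ => by ring

/-- Transposition of the rigidity matrix: it lets the derivative of the errors be written as a
pairing with the force. -/
theorem inner_force (G : OrientedGraph V E) (z : Stacked E) (x : EuclideanSpace ℝ E)
    (v : Stacked V) :
    inner ℝ (G.force z x) v = ∑ k, x k * inner ℝ (block z k) (block (G.relPos v) k) := by
  simp_rw [← rigidityMatrix_mulVec]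
  have : inner ℝ (G.force z x) v = ((G.rigidityMatrix z)ᵀ *ᵥ x.ofLp) ⬝ᵥ v.ofLp := by
    simp [force, EuclideanSpace.inner_eq_star_dotProduct, dotProduct_comm]
  rw [this, Matrix.mulVec_transpose, ← Matrix.dotProduct_mulVec]
  rfl

theorem force_smul (G : OrientedGraph V E) (z : Stacked E) (c : ℝ) (x : EuclideanSpace ℝ E) :
    G.force z (c • x) = c • G.force z x := by
  simp [force, Matrix.mulVec_smul]

theorem continuous_force (G : OrientedGraph V E) :
    Continuous fun q : Stacked E × EuclideanSpace ℝ E => G.force q.1 q.2 := by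
  refine continuous_stacked fun i => ?_
  simp only [block_force]
  have := fun k : E => continuous_block (ι := E) k
  have h2 : ∀ k : E, Continuous fun q : Stacked E × EuclideanSpace ℝ E => q.2 k := fun k =>
    (EuclideanSpace.proj (𝕜 := ℝ) k).continuous.comp continuous_snd
  fun_prop

end Rigidity

section Satellites

theorem block_rigidPart (p : Stacked (V ⊕ W)) (i : V) :
    block (rigidPart p) i = block p (Sum.inl i) := rfl

/-- The part of a stacked vector that belongs to the rigid agents, as a linear map. -/
def rigidPartₗ : Stacked (V ⊕ W) →ₗ[ℝ] Stacked V where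
  toFun := rigidPart
  map_add' _ _ := rfl
  map_smul' _ _ := rfl

theorem continuous_rigidPart [Fintype V] [Fintype W] :
    Continuous (rigidPart : Stacked (V ⊕ W) → Stacked V) :=
  rigidPartₗ.continuous_of_finiteDimensional

theorem norm_rigidPart_le [Fintype V] [Fintype W] (p : Stacked (V ⊕ W)) :
    ‖rigidPart p‖ ≤ ‖p‖ := by
  refine (pow_le_pow_iff_left₀ (norm_nonneg _) (norm_nonneg _) two_ne_zero).1 ?_
  simp only [norm_sq_eq_sum_block, Fintype.sum_sum_type, block_rigidPart]
  have : 0 ≤ ∑ s : W, ‖block p (Sum.inr s)‖ ^ 2 := Finset.sum_nonneg fun _ _ => by positivity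
  linarith

variable [Fintype V] [Fintype E] [Fintype W] [DecidableEq V] [DecidableEq E] [DecidableEq W]
  (G : OrientedGraph V E) (a : W → V)

theorem rigidPart_relPos (p : Stacked (V ⊕ W)) :
    rigidPart ((G.withSatellites a).relPos p) = G.relPos (rigidPart p) :=
  stacked_ext fun k => by
    rw [block_rigidPart, block_relPos, block_relPos]
    rfl

theorem block_relPos_inr (p : Stacked (V ⊕ W)) (s : W) :
    block ((G.withSatellites a).relPos p) (Sum.inr s) =
      block p (Sum.inr s) - block p (Sum.inl (a s)) := by
  rw [block_relPos]
  rfl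

/-- A satellite meets only its own edge, as the tail, so a single term of the sum survives. -/
theorem block_force_inr (z : Stacked (E ⊕ W)) (x : EuclideanSpace ℝ (E ⊕ W)) (s : W) :
    block ((G.withSatellites a).force z x) (Sum.inr s) =
      x (Sum.inr s) • block z (Sum.inr s) := by
  rw [block_force, Fintype.sum_sum_type]
  simp [incidence, withSatellites, ite_smul]

theorem closedLoop_eq (d : E ⊕ W → ℝ) (p : Stacked (V ⊕ W)) :
    G.closedLoop a d p =
      -(G.withSatellites a).force ((G.withSatellites a).relPos p)
        (distErr d ((G.withSatellites a).relPos p)) +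
      WithLp.toLp 2 (bar (G.satelliteMatrix a) *ᵥ
        (perp ((G.withSatellites a).relPos p)).ofLp) := rfl

/-- The stacked vector `(S ⊗ I₂) y`. -/
noncomputable def spin (y : Stacked (E ⊕ W)) : Stacked (V ⊕ W) :=
  WithLp.toLp 2 (bar (G.satelliteMatrix a) *ᵥ y.ofLp)

theorem block_spin (y : Stacked (E ⊕ W)) (i : V ⊕ W) :
    block (G.spin a y) i = Sum.elim (fun _ => 0) (fun s => block y (Sum.inr s)) i := by
  ext c
  rcases i with i | s <;>
  simp [spin, bar, Matrix.mulVec, dotProduct, Matrix.one_apply, satelliteMatrix, incidence,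
    Fintype.sum_prod_type, Matrix.kroneckerMap_apply, withSatellites, ite_mul]

theorem block_closedLoop_inl (d : E ⊕ W → ℝ) (p : Stacked (V ⊕ W)) (i : V) :
    block (G.closedLoop a d p) (Sum.inl i) =
      -block ((G.withSatellites a).force ((G.withSatellites a).relPos p)
        (distErr d ((G.withSatellites a).relPos p))) (Sum.inl i) := by
  have h := G.block_spin a (perp ((G.withSatellites a).relPos p)) (Sum.inl i)
  rw [closedLoop_eq, block_add]
  change _ + block (G.spin a _) _ = _
  rw [h, Sum.elim_inl, add_zero]
  rfl

theorem block_closedLoop_inr (d : E ⊕ W → ℝ) (p : Stacked (V ⊕ W)) (s : W) :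
    block (G.closedLoop a d p) (Sum.inr s) =
      -(distErr d ((G.withSatellites a).relPos p) (Sum.inr s) •
        block ((G.withSatellites a).relPos p) (Sum.inr s)) +
      cw (block ((G.withSatellites a).relPos p) (Sum.inr s)) := by
  have h := G.block_spin a (perp ((G.withSatellites a).relPos p)) (Sum.inr s)
  rw [closedLoop_eq, block_add]
  change _ + block (G.spin a _) _ = _
  rw [h, Sum.elim_inr, block_perp, ← block_force_inr G a]
  rfl

/-- The energy identity: `⟨R(z)ᵀ e, ṗ⟩ = -‖R(z)ᵀ e‖²` along the closed loop. -/
theorem inner_force_closedLoop (d : E ⊕ W → ℝ) (p : Stacked (V ⊕ W)) :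
    inner ℝ ((G.withSatellites a).force ((G.withSatellites a).relPos p)
        (distErr d ((G.withSatellites a).relPos p))) (G.closedLoop a d p) =
      -‖(G.withSatellites a).force ((G.withSatellites a).relPos p)
        (distErr d ((G.withSatellites a).relPos p))‖ ^ 2 := by
  rw [closedLoop_eq, inner_add_right, inner_neg_right, real_inner_self_eq_norm_sq]
  suffices h : inner ℝ ((G.withSatellites a).force ((G.withSatellites a).relPos p)
      (distErr d ((G.withSatellites a).relPos p)))
      (G.spin a (perp ((G.withSatellites a).relPos p))) = 0 by
    have h' := h
    unfold spin at h'
    rw [h', add_zero]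
  -- The spin vanishes on rigid agents; on a satellite the force is a multiple of `z_s` and the spin
  -- is `cw z_s`.
  rw [inner_eq_sum_block, Fintype.sum_sum_type]
  simp [block_spin, block_force_inr, block_perp, inner_smul_left,
    inner_cw_self]

end Satellites

end OrientedGraph

/-! ### Planar rotations -/

/-- The counterclockwise rotation of the plane by the angle `φ`. -/
noncomputable def rot (φ : ℝ) : Matrix.specialOrthogonalGroup (Fin 2) ℝ :=
  ⟨!![Real.cos φ, -Real.sin φ; Real.sin φ, Real.cos φ],
    Matrix.of_mem_specialOrthogonalGroup_fin_two_iff.2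
      ⟨rfl, rfl, by simp⟩⟩

theorem rotate_apply_zero (T : Matrix (Fin 2) (Fin 2) ℝ) (v : EuclideanSpace ℝ (Fin 2)) :
    rotate T v 0 = T 0 0 * v 0 + T 0 1 * v 1 := by
  simp [rotate]

theorem rotate_apply_one (T : Matrix (Fin 2) (Fin 2) ℝ) (v : EuclideanSpace ℝ (Fin 2)) :
    rotate T v 1 = T 1 0 * v 0 + T 1 1 * v 1 := by
  simp [rotate]

theorem rotate_rot_zero (φ : ℝ) (v : EuclideanSpace ℝ (Fin 2)) :
    rotate (rot φ : Matrix (Fin 2) (Fin 2) ℝ) v 0 = Real.cos φ * v 0 - Real.sin φ * v 1 := by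
  rw [rotate_apply_zero]; simp [rot]; ring

theorem rotate_rot_one (φ : ℝ) (v : EuclideanSpace ℝ (Fin 2)) :
    rotate (rot φ : Matrix (Fin 2) (Fin 2) ℝ) v 1 = Real.sin φ * v 0 + Real.cos φ * v 1 := by
  rw [rotate_apply_one]; simp [rot]

theorem plane_ext {v w : EuclideanSpace ℝ (Fin 2)} (h0 : v 0 = w 0) (h1 : v 1 = w 1) : v = w := by
  ext c
  fin_cases c
  · exact h0
  · exact h1

theorem rotate_sub (T : Matrix (Fin 2) (Fin 2) ℝ) (v w : EuclideanSpace ℝ (Fin 2)) :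
    rotate T (v - w) = rotate T v - rotate T w := by
  apply plane_ext <;> simp [rotate_apply_zero, rotate_apply_one] <;> ring

theorem rotate_one (v : EuclideanSpace ℝ (Fin 2)) : rotate 1 v = v := by
  simp [rotate]

theorem norm_sq_fin_two (v : EuclideanSpace ℝ (Fin 2)) : ‖v‖ ^ 2 = v 0 ^ 2 + v 1 ^ 2 := by
  rw [← real_inner_self_eq_norm_sq, inner_fin_two]; ring

theorem norm_eq_of_norm_sq_eq {F F' : Type*} [SeminormedAddCommGroup F] [SeminormedAddCommGroup F']
    {v : F} {w : F'} (h : ‖v‖ ^ 2 = ‖w‖ ^ 2) : ‖v‖ = ‖w‖ :=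
  (pow_left_inj₀ (norm_nonneg _) (norm_nonneg _) two_ne_zero).1 h

theorem norm_rotate (T : Matrix.specialOrthogonalGroup (Fin 2) ℝ)
    (v : EuclideanSpace ℝ (Fin 2)) : ‖rotate (T : Matrix (Fin 2) (Fin 2) ℝ) v‖ = ‖v‖ := by
  obtain ⟨h1, h2, h3⟩ := Matrix.mem_specialOrthogonalGroup_fin_two_iff.1 T.2
  refine norm_eq_of_norm_sq_eq ?_
  rw [norm_sq_fin_two, norm_sq_fin_two, rotate_apply_zero, rotate_apply_one, ← h1, ← neg_eq_iff_eq_neg.2 h2]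
  linear_combination (v 0 ^ 2 + v 1 ^ 2) * h3

theorem exists_cos_sin {α β : ℝ} (h : α ^ 2 + β ^ 2 = 1) :
    ∃ φ : ℝ, Real.cos φ = α ∧ Real.sin φ = β := by
  have hn : ‖(⟨α, β⟩ : ℂ)‖ = 1 := by
    rw [Complex.norm_def, Complex.normSq_mk, ← sq, ← sq, h, Real.sqrt_one]
  have h0 : (⟨α, β⟩ : ℂ) ≠ 0 := by
    rw [← norm_pos_iff, hn]; exact one_pos
  refine ⟨Complex.arg ⟨α, β⟩, ?_, ?_⟩
  · rw [Complex.cos_arg h0, hn, div_one]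
  · rw [Complex.sin_arg, hn, div_one]

theorem exists_rotate_eq {u v : EuclideanSpace ℝ (Fin 2)} (h : ‖u‖ = ‖v‖) :
    ∃ φ, rotate (rot φ : Matrix (Fin 2) (Fin 2) ℝ) u = v := by
  have h2 : u 0 ^ 2 + u 1 ^ 2 = v 0 ^ 2 + v 1 ^ 2 := by
    rw [← norm_sq_fin_two, ← norm_sq_fin_two, h]
  by_cases hu : u = 0
  · subst hu
    have hv : v = 0 := by simpa using h.symm
    exact ⟨0, by subst hv; apply plane_ext <;> simp [rotate_rot_zero, rotate_rot_one]⟩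
  · have hpos : 0 < u 0 ^ 2 + u 1 ^ 2 := by
      rw [← norm_sq_fin_two]
      have := norm_pos_iff.2 hu
      positivity
    -- The normalized dot and cross products of `u` and `v`.
    obtain ⟨φ, hc, hs⟩ := exists_cos_sin
      (α := (u 0 * v 0 + u 1 * v 1) / (u 0 ^ 2 + u 1 ^ 2))
      (β := (u 0 * v 1 - u 1 * v 0) / (u 0 ^ 2 + u 1 ^ 2)) (by
        field_simp
        linear_combination -(u 0 ^ 2 + u 1 ^ 2) * h2)
    refine ⟨φ, plane_ext ?_ ?_⟩
    · rw [rotate_rot_zero, hc, hs]; field_simp; ring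
    · rw [rotate_rot_one, hc, hs]; field_simp; ring

/-- The Cayley transform of an infinitesimal rotation is a rotation. -/
theorem exists_rot_of_sub_eq_smul_cw (ω : ℝ) :
    ∃ φ, ∀ u v : EuclideanSpace ℝ (Fin 2), v - u = ω • cw (u + v) →
      v = rotate (rot φ : Matrix (Fin 2) (Fin 2) ℝ) u := by
  have hpos : 0 < 1 + ω ^ 2 := by positivity
  -- With the plane as ℂ, `cw` is multiplication by $-i$ and the equation reads
  -- $v=\frac{1-i\omega}{1+i\omega}u$; these are the real and imaginary parts of the factor. It
  -- depends on `ω` alone, so one angle serves all edges of a formation.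
  obtain ⟨φ, hc, hs⟩ := exists_cos_sin (α := (1 - ω ^ 2) / (1 + ω ^ 2))
    (β := -(2 * ω) / (1 + ω ^ 2)) (by field_simp; ring)
  refine ⟨φ, fun u v h => ?_⟩
  have h0 : v 0 - u 0 = ω * (u 1 + v 1) := congrArg (fun w => w.ofLp 0) h
  have h1 : v 1 - u 1 = ω * -(u 0 + v 0) := congrArg (fun w => w.ofLp 1) h
  apply plane_ext
  · rw [rotate_rot_zero, hc, hs]
    field_simp
    linear_combination h0 + ω * h1
  · rw [rotate_rot_one, hc, hs]
    field_simp
    linear_combination h1 - ω * h0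

theorem cw_sub (v w : EuclideanSpace ℝ (Fin 2)) : cw (v - w) = cw v - cw w := by
  apply plane_ext <;> simp [cw]; ring

theorem cw_eq_zero {v : EuclideanSpace ℝ (Fin 2)} (h : cw v = 0) : v = 0 := by
  have h0 : v 1 = 0 := congrArg (fun w => w.ofLp 0) h
  have h1 : -v 0 = 0 := congrArg (fun w => w.ofLp 1) h
  exact plane_ext (by simpa using h1) h0

/-! ### Infinitesimal rigidity -/

namespace OrientedGraph

variable {V E W : Type*} [Fintype V] [Fintype E] [Fintype W] [DecidableEq V] [DecidableEq E]
  [DecidableEq W]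

/-- The rows of the rigidity matrix `R(z)` are linearly independent. -/
def IndepAt (G : OrientedGraph V E) (z : Stacked E) : Prop :=
  ∀ x, G.force z x = 0 → x = 0

theorem indepAt_iff_rank (G : OrientedGraph V E) (z : Stacked E) :
    G.IndepAt z ↔ (G.rigidityMatrix z).rank = Fintype.card E := by
  have hker : G.IndepAt z ↔ LinearMap.ker (G.rigidityMatrix z)ᵀ.mulVecLin = ⊥ := by
    rw [LinearMap.ker_eq_bot']
    constructor
    · intro h m hm
      have := h (WithLp.toLp 2 m) (by
        rw [Matrix.mulVecLin_apply] at hm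
        simp [force, hm])
      simpa using this
    · intro h x hx
      have := h x.ofLp (congrArg WithLp.ofLp hx)
      simpa using this
  have hrn := LinearMap.finrank_range_add_finrank_ker (G.rigidityMatrix z)ᵀ.mulVecLin
  rw [Module.finrank_fintype_fun_eq_card] at hrn
  rw [hker, ← Submodule.finrank_eq_zero (R := ℝ), ← Matrix.rank_transpose, Matrix.rank]
  omega

/-- A row in the span of the others could be removed without changing the rank, against minimality.
Hence the rows are independent and the rank `2 |V| - 3` counts the edges. -/
theorem MinInfRigid.card_eq {G : OrientedGraph V E} {p : Stacked V} (h : G.MinInfRigid p) :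
    Fintype.card E + 3 = 2 * Fintype.card V := by
  obtain ⟨h1, h2⟩ := h
  have hli : LinearIndependent ℝ (G.rigidityMatrix (G.relPos p)).row := by
    rw [linearIndependent_iff_notMem_span]
    intro k hk
    refine h2 k ?_
    unfold InfRigid at h1 ⊢
    rw [← h1, Matrix.rank_eq_finrank_span_row, Matrix.rank_eq_finrank_span_row]
    have hrow : ∀ j : {k' : E // k' ≠ k},
        ((G.removeEdge k).rigidityMatrix ((G.removeEdge k).relPos p)).row j =
          (G.rigidityMatrix (G.relPos p)).row j := by
      intro j
      ext ⟨i, c⟩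
      simp only [Matrix.row, rigidityMatrix_apply, ← block_apply, block_relPos]
      rfl
    have hrange : Set.range ((G.removeEdge k).rigidityMatrix ((G.removeEdge k).relPos p)).row =
        (G.rigidityMatrix (G.relPos p)).row '' (Set.univ \ {k}) := by
      ext r
      constructor
      · rintro ⟨j, rfl⟩
        exact ⟨j, ⟨trivial, j.2⟩, (hrow j).symm⟩
      · rintro ⟨j, ⟨-, hj⟩, rfl⟩
        exact ⟨⟨j, hj⟩, hrow _⟩
    have hspan : Submodule.span ℝ ((G.rigidityMatrix (G.relPos p)).row '' (Set.univ \ {k})) =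
        Submodule.span ℝ (Set.range (G.rigidityMatrix (G.relPos p)).row) := by
      refine le_antisymm (Submodule.span_mono (Set.image_subset_range _ _)) ?_
      rw [Submodule.span_le]
      rintro _ ⟨j, rfl⟩
      by_cases hj : j = k
      · rw [hj]; exact hk
      · exact Submodule.subset_span ⟨j, ⟨trivial, hj⟩, rfl⟩
    rw [hrange, hspan]
  rw [← h1, hli.rank_matrix]

theorem indepAt_iff_infRigid {G : OrientedGraph V E}
    (hcard : Fintype.card E + 3 = 2 * Fintype.card V) (p : Stacked V) :
    G.IndepAt (G.relPos p) ↔ G.InfRigid p := by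
  rw [indepAt_iff_rank, InfRigid]
  omega

theorem IndepAt.block_ne_zero {G : OrientedGraph V E} {z : Stacked E} (h : G.IndepAt z) (k : E) :
    block z k ≠ 0 := by
  intro hk
  have := h (EuclideanSpace.single k 1) (stacked_ext fun i => by
    rw [block_force]
    refine Finset.sum_eq_zero fun k' _ => ?_
    by_cases hkk : k' = k
    · rw [hkk, hk, smul_zero]
    · simp [hkk])
  simpa using congrArg (fun x => x.ofLp k) this

/-- The infinitesimal motions of a placement that are due to translations and rotations. -/
noncomputable def trivialMotion (m : Stacked V) :
    EuclideanSpace ℝ (Fin 2) × ℝ →ₗ[ℝ] Stacked V where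
  toFun q := WithLp.toLp 2 fun ic => q.1 ic.2 + q.2 * cw (block m ic.1) ic.2
  map_add' q q' := by ext ic; simp; ring
  map_smul' c q := by ext ic; simp; ring

theorem block_trivialMotion (m : Stacked V) (q : EuclideanSpace ℝ (Fin 2) × ℝ) (i : V) :
    block (trivialMotion m q) i = q.1 + q.2 • cw (block m i) := rfl

theorem block_relPos_trivialMotion (G : OrientedGraph V E) (m : Stacked V)
    (q : EuclideanSpace ℝ (Fin 2) × ℝ) (k : E) :
    block (G.relPos (trivialMotion m q)) k = q.2 • cw (block (G.relPos m) k) := by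
  rw [block_relPos, block_trivialMotion, block_trivialMotion, block_relPos, cw_sub, smul_sub]
  abel

/-- A dimension count: the kernel of `R` has dimension `2 |V| - |E| = 3` and contains the trivial
motions, which also form a space of dimension 3. -/
theorem IndepAt.exists_eq_trivialMotion {G : OrientedGraph V E}
    (hcard : Fintype.card E + 3 = 2 * Fintype.card V) {m : Stacked V}
    (h : G.IndepAt (G.relPos m)) {v : Stacked V}
    (hv : ∀ k, inner ℝ (block (G.relPos m) k) (block (G.relPos v) k) = 0) :
    ∃ q, v = trivialMotion m q := by
  -- Without edges the count would read `3 = 2 |V|`. A nonzero edge is what distinguishes a rotation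
  -- from a translation.
  obtain ⟨k₀⟩ : Nonempty E := by
    by_contra hE
    rw [not_nonempty_iff] at hE
    rw [Fintype.card_eq_zero] at hcard
    omega
  obtain ⟨i₀⟩ : Nonempty V := ⟨G.tail k₀⟩
  set A : Stacked V →ₗ[ℝ] (E → ℝ) := (G.rigidityMatrix (G.relPos m)).mulVecLin ∘ₗ
    (WithLp.linearEquiv 2 ℝ (V × Fin 2 → ℝ)).toLinearMap with hA
  have hAk : ∀ u k, A u k = inner ℝ (block (G.relPos m) k) (block (G.relPos u) k) :=
    fun u k => rigidityMatrix_mulVec G _ u k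
  have hinj : LinearMap.ker (trivialMotion m) = ⊥ := by
    rw [LinearMap.ker_eq_bot']
    intro q hq
    have h2 : q.2 = 0 := by
      have := block_relPos_trivialMotion G m q k₀
      rw [hq, block_relPos] at this
      have h0 : q.2 • cw (block (G.relPos m) k₀) = 0 := by
        rw [← this]; exact sub_self _
      exact (smul_eq_zero.1 h0).resolve_right fun hc => h.block_ne_zero k₀ (cw_eq_zero hc)
    have h1 := block_trivialMotion m q i₀
    rw [hq, h2, zero_smul, add_zero] at h1
    exact Prod.ext h1.symm h2
  have hle : LinearMap.range (trivialMotion m) ≤ LinearMap.ker A := by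
    rintro _ ⟨q, rfl⟩
    rw [LinearMap.mem_ker]
    ext k
    rw [hAk, block_relPos_trivialMotion, inner_smul_right, inner_cw_self, mul_zero]
    rfl
  have hrank : Module.finrank ℝ (LinearMap.range A) = Fintype.card E := by
    rw [← (indepAt_iff_rank _ _).1 h, Matrix.rank, hA, LinearMap.range_comp_of_range_eq_top]
    exact LinearEquiv.range _
  have hdim := LinearMap.finrank_range_add_finrank_ker A
  have hdim' := LinearMap.finrank_range_add_finrank_ker (trivialMotion m)
  rw [hrank, finrank_euclideanSpace, Fintype.card_prod, Fintype.card_fin] at hdim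
  rw [hinj, finrank_bot, Module.finrank_prod, finrank_euclideanSpace, Fintype.card_fin,
    Module.finrank_self] at hdim'
  have heq := Submodule.eq_of_le_of_finrank_eq hle (by omega)
  have hvA : v ∈ LinearMap.ker A := by
    rw [LinearMap.mem_ker]
    ext k
    rw [hAk, hv]
    rfl
  rw [← heq] at hvA
  obtain ⟨q, hq⟩ := hvA
  exact ⟨q, hq.symm⟩

/-- This takes the place of connectedness of the graph: `v` is an infinitesimal motion, hence
trivial, and its rotational part must vanish because the edges of `m` are nonzero. -/
theorem IndepAt.exists_block_eq_of_relPos_eq_zero {G : OrientedGraph V E}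
    (hcard : Fintype.card E + 3 = 2 * Fintype.card V) {m : Stacked V}
    (h : G.IndepAt (G.relPos m)) {v : Stacked V} (hv : G.relPos v = 0) :
    ∃ τ, ∀ i, block v i = τ := by
  obtain ⟨q, rfl⟩ := h.exists_eq_trivialMotion hcard (v := v) fun k => by
    rw [hv]; exact inner_zero_right _
  obtain ⟨k₀⟩ : Nonempty E := by
    by_contra hE
    rw [not_nonempty_iff] at hE
    rw [Fintype.card_eq_zero] at hcard
    omega
  have h0 : q.2 • cw (block (G.relPos m) k₀) = 0 := by
    rw [← block_relPos_trivialMotion, hv]; rfl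
  have h2 : q.2 = 0 :=
    (smul_eq_zero.1 h0).resolve_right fun hc => h.block_ne_zero k₀ (cw_eq_zero hc)
  exact ⟨q.1, fun i => by rw [block_trivialMotion, h2, zero_smul, add_zero]⟩

/-- Two placements with equal edge lengths whose midpoint has independent rows are congruent. -/
theorem exists_rotate_of_indepAt_midpoint {G : OrientedGraph V E}
    (hcard : Fintype.card E + 3 = 2 * Fintype.card V) {p q : Stacked V}
    (h : G.IndepAt ((2⁻¹ : ℝ) • (G.relPos p + G.relPos q)))
    (hpq : ∀ k, ‖block (G.relPos p) k‖ = ‖block (G.relPos q) k‖) :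
    ∃ φ, ∀ k, block (G.relPos p) k =
      rotate (rot φ : Matrix (Fin 2) (Fin 2) ℝ) (block (G.relPos q) k) := by
  rw [← relPos_add, ← relPos_smul] at h
  -- On each edge $\langle u+v,u-v\rangle=\|u\|^2-\|v\|^2=0$, so `p - q` is an infinitesimal motion
  -- of the midpoint.
  obtain ⟨y, hy⟩ := h.exists_eq_trivialMotion hcard (v := p - q) fun k => by
    rw [relPos_smul, relPos_add, relPos_sub, block_smul, block_add, block_sub, inner_smul_left,
      real_inner_add_sub_eq_zero_iff _ _ |>.2 (hpq k), mul_zero]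
  -- The factor `2⁻¹` is that of the midpoint, moved from the placement to the angular velocity.
  obtain ⟨φ, hφ⟩ := exists_rot_of_sub_eq_smul_cw (2⁻¹ * y.2)
  refine ⟨φ, fun k => hφ _ _ ?_⟩
  rw [← block_sub, ← relPos_sub, hy, block_relPos_trivialMotion, relPos_smul, relPos_add,
    block_smul, block_add, add_comm (block (G.relPos p) k)]
  apply plane_ext <;> simp [cw] <;> ring

/-- The balance at a satellite is `x_s z_s = 0`, which removes the satellite coefficients and leaves
the balance of `G` alone. -/
theorem indepAt_withSatellites {G : OrientedGraph V E} {a : W → V} {z : Stacked (E ⊕ W)}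
    (h : G.IndepAt (rigidPart z)) (hz : ∀ s : W, block z (Sum.inr s) ≠ 0) :
    (G.withSatellites a).IndepAt z := by
  intro x hx
  have hs : ∀ s, x (Sum.inr s) = 0 := fun s => by
    have h1 := block_force_inr G a z x s
    rw [hx] at h1
    exact (smul_eq_zero.1 h1.symm).resolve_right (hz s)
  have hE := h (WithLp.toLp 2 fun k => x (Sum.inl k)) (stacked_ext fun i => by
    have h1 := block_force (G.withSatellites a) z x (Sum.inl i)
    rw [hx, Fintype.sum_sum_type] at h1
    simp only [hs, mul_zero, zero_smul, Finset.sum_const_zero, add_zero] at h1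
    rw [block_force]
    refine Eq.trans (Finset.sum_congr rfl fun k _ => ?_) h1.symm
    simp [incidence, withSatellites, block_rigidPart])
  ext k
  rcases k with k | s
  · exact congrArg (fun y => y.ofLp k) hE
  · exact hs s

end OrientedGraph

/-! ### Orbits under rotations, and the ambit -/

theorem block_rotateBlocks {ι : Type*} (T : ι → Matrix.specialOrthogonalGroup (Fin 2) ℝ)
    (z : Stacked ι) (k : ι) :
    block (rotateBlocks T z) k = rotate (T k : Matrix (Fin 2) (Fin 2) ℝ) (block z k) := rfl

theorem continuous_rotate {X : Type*} [TopologicalSpace X] {T : X → Matrix (Fin 2) (Fin 2) ℝ}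
    {v : X → EuclideanSpace ℝ (Fin 2)} (hT : Continuous T) (hv : Continuous v) :
    Continuous fun x => rotate (T x) (v x) :=
  (PiLp.continuous_toLp 2 _).comp (hT.matrix_mulVec ((PiLp.continuous_ofLp 2 _).comp hv))

theorem continuous_rot : Continuous rot := by
  refine Continuous.subtype_mk (continuous_matrix fun i j => ?_) _
  fin_cases i <;> fin_cases j <;> simp <;> fun_prop

theorem rot_zero : rot 0 = 1 := by
  refine Subtype.ext ?_
  ext i j
  fin_cases i <;> fin_cases j <;> simp [rot]

/-- The set of all the copies of `z` rotated as a whole. -/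
def orbit {ι : Type*} (z : Stacked ι) : Set (Stacked ι) :=
  Set.range fun φ : ℝ => rotateBlocks (fun _ => rot φ) z

theorem mem_orbit {ι : Type*} {y z : Stacked ι} :
    y ∈ orbit z ↔
      ∃ φ, ∀ k, block y k = rotate (rot φ : Matrix (Fin 2) (Fin 2) ℝ) (block z k) := by
  constructor
  · rintro ⟨φ, rfl⟩
    exact ⟨φ, fun k => rfl⟩
  · rintro ⟨φ, h⟩
    exact ⟨φ, (stacked_ext h).symm⟩

theorem self_mem_orbit {ι : Type*} (z : Stacked ι) : z ∈ orbit z :=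
  mem_orbit.2 ⟨0, fun k => by rw [rot_zero]; exact (rotate_one _).symm⟩

theorem isCompact_orbit {ι : Type*} [Fintype ι] (z : Stacked ι) : IsCompact (orbit z) := by
  refine Function.Periodic.compact_of_continuous (c := 2 * Real.pi) ?_ Real.two_pi_pos.ne' ?_
  · intro φ
    have : rot (φ + 2 * Real.pi) = rot φ := by simp [rot]
    simp only [this]
  · exact continuous_stacked fun k =>
      continuous_rotate (v := fun _ => block z k) (continuous_subtype_val.comp continuous_rot)
        continuous_const

theorem norm_block_of_mem_orbit {ι : Type*} {y z : Stacked ι} (h : y ∈ orbit z) (k : ι) :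
    ‖block y k‖ = ‖block z k‖ := by
  obtain ⟨φ, hφ⟩ := mem_orbit.1 h
  rw [hφ, norm_rotate]

/-- A planar matrix as a linear map. -/
noncomputable def rotateₗ (T : Matrix (Fin 2) (Fin 2) ℝ) :
    EuclideanSpace ℝ (Fin 2) →ₗ[ℝ] EuclideanSpace ℝ (Fin 2) where
  toFun := rotate T
  map_add' v w := by apply plane_ext <;> simp [rotate_apply_zero, rotate_apply_one] <;> ring
  map_smul' c v := by apply plane_ext <;> simp [rotate_apply_zero, rotate_apply_one] <;> ring

theorem rot_mul_rot (φ ψ : ℝ) (v : EuclideanSpace ℝ (Fin 2)) :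
    rotate (rot φ : Matrix (Fin 2) (Fin 2) ℝ) (rotate (rot ψ : Matrix (Fin 2) (Fin 2) ℝ) v) =
      rotate (rot (φ + ψ) : Matrix (Fin 2) (Fin 2) ℝ) v := by
  apply plane_ext <;> simp only [rotate_rot_zero, rotate_rot_one, Real.cos_add, Real.sin_add] <;>
    ring

theorem orbit_trans {ι : Type*} {x y z : Stacked ι} (h1 : x ∈ orbit y) (h2 : y ∈ orbit z) :
    x ∈ orbit z := by
  obtain ⟨φ, hφ⟩ := mem_orbit.1 h1
  obtain ⟨ψ, hψ⟩ := mem_orbit.1 h2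
  exact mem_orbit.2 ⟨φ + ψ, fun k => by rw [hφ, hψ, rot_mul_rot]⟩

/-- A placement in which every agent is rotated by the angle `φ` around the origin. -/
noncomputable def rotatePlacement {ι : Type*} (φ : ℝ) (p : Stacked ι) : Stacked ι :=
  rotateBlocks (fun _ => rot φ) p

namespace OrientedGraph

variable {V E W : Type*} [Fintype V] [Fintype E] [Fintype W] [DecidableEq V] [DecidableEq E]
  [DecidableEq W]

theorem block_relPos_rotatePlacement (G : OrientedGraph V E) (φ : ℝ) (p : Stacked V) (k : E) :
    block (G.relPos (rotatePlacement φ p)) k =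
      rotate (rot φ : Matrix (Fin 2) (Fin 2) ℝ) (block (G.relPos p) k) := by
  rw [block_relPos, block_relPos, rotate_sub]
  rfl

theorem orbit_relPos_subset_range (G : OrientedGraph V E) (p : Stacked V) :
    orbit (G.relPos p) ⊆ Set.range G.relPos := by
  intro y hy
  obtain ⟨φ, hφ⟩ := mem_orbit.1 hy
  exact ⟨rotatePlacement φ p, stacked_ext fun k => by
    rw [block_relPos_rotatePlacement, hφ]⟩

theorem IndepAt.of_mem_orbit {G : OrientedGraph V E} {y z : Stacked E} (hz : G.IndepAt z)
    (h : y ∈ orbit z) : G.IndepAt y := by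
  obtain ⟨φ, hφ⟩ := mem_orbit.1 h
  intro x hx
  refine hz x (stacked_ext fun i => ?_)
  have h1 : block (G.force y x) i = rotateₗ (rot φ) (block (G.force z x) i) := by
    rw [block_force, block_force, map_sum]
    refine Finset.sum_congr rfl fun k _ => ?_
    rw [map_smul, hφ]
    rfl
  rw [hx] at h1
  have h2 : ‖block (G.force z x) i‖ = 0 := by
    rw [← norm_rotate (rot φ)]
    change ‖rotateₗ (rot φ) (block (G.force z x) i)‖ = 0
    rw [← h1]
    exact norm_zero
  exact norm_eq_zero.1 h2

/-- Independence of rows is an open condition, and compactness of `K` makes the margin uniform. -/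
theorem exists_indepAt_of_infDist_le {G : OrientedGraph V E} {K : Set (Stacked E)}
    (hK : IsCompact K) (hne : K.Nonempty) (hI : ∀ z ∈ K, G.IndepAt z) :
    ∃ b, 0 < b ∧ ∀ z, Metric.infDist z K ≤ b → G.IndepAt z := by
  have hcomp : IsCompact {z | Metric.infDist z K ≤ 1} := by
    refine Metric.isCompact_of_isClosed_isBounded
      (isClosed_le (Metric.continuous_infDist_pt K) continuous_const)
      ((hK.isBounded.thickening (δ := 2)).subset fun z hz => ?_)
    rw [Metric.mem_thickening_iff_infDist_lt hne]
    exact lt_of_le_of_lt hz one_lt_two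
  obtain ⟨b, hb, -, lam, hlam, h⟩ := exists_lower_bound_of_injective (Metric.continuous_infDist_pt K)
    hcomp G.continuous_force G.force_smul (fun z hz => hI z (by
      rw [hK.isClosed.mem_iff_infDist_zero hne]
      exact le_antisymm hz Metric.infDist_nonneg))
  refine ⟨b, hb, fun z hz x hx => ?_⟩
  have := h z hz x
  rw [hx, norm_zero] at this
  exact norm_le_zero_iff.1 (nonpos_of_mul_nonpos_right this hlam)

/-- Local uniqueness of shapes with given edge lengths: a shape close to `z` has with it a midpoint
close to `K`, where the rows are independent, so the two are congruent. -/
theorem exists_forall_mem_orbit {G : OrientedGraph V E}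
    (hcard : Fintype.card E + 3 = 2 * Fintype.card V) {K : Set (Stacked E)}
    (hK : IsCompact K) (hne : K.Nonempty) (hKr : K ⊆ Set.range G.relPos)
    (hI : ∀ z ∈ K, G.IndepAt z) :
    ∃ b, 0 < b ∧ ∀ y ∈ Set.range G.relPos, ∀ z ∈ K, dist y z < b →
      (∀ k, ‖block y k‖ = ‖block z k‖) → y ∈ orbit z := by
  obtain ⟨b, hb, h⟩ := exists_indepAt_of_infDist_le hK hne hI
  refine ⟨b, hb, ?_⟩
  rintro _ ⟨p, rfl⟩ z hz hdist hnorm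
  obtain ⟨q, rfl⟩ := hKr hz
  refine mem_orbit.2 (exists_rotate_of_indepAt_midpoint hcard (h _ ?_) hnorm)
  refine (Metric.infDist_le_dist_of_mem hz).trans ?_
  have : (2⁻¹ : ℝ) • (G.relPos p + G.relPos q) - G.relPos q =
      (2⁻¹ : ℝ) • (G.relPos p - G.relPos q) := by
    module
  rw [dist_eq_norm, this, norm_smul, ← dist_eq_norm, Real.norm_of_nonneg (by norm_num)]
  have := dist_nonneg (x := G.relPos p) (y := G.relPos q)
  linarith

/-- The placement with rigid agents at `x` and with satellites displaced from their neighbours by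
the vectors `y s`. -/
noncomputable def attach (a : W → V) (x : Stacked V) (y : W → EuclideanSpace ℝ (Fin 2)) :
    Stacked (V ⊕ W) :=
  WithLp.toLp 2 fun ic => Sum.elim (block x) (fun s => block x (a s) + y s) ic.1 ic.2

theorem rigidPart_attach (a : W → V) (x : Stacked V) (y : W → EuclideanSpace ℝ (Fin 2)) :
    rigidPart (attach a x y) = x := rfl

theorem block_relPos_attach_inr (G : OrientedGraph V E) (a : W → V) (x : Stacked V)
    (y : W → EuclideanSpace ℝ (Fin 2)) (s : W) :
    block ((G.withSatellites a).relPos (attach a x y)) (Sum.inr s) = y s := by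
  rw [block_relPos_inr]
  exact add_sub_cancel_left (block x (a s)) (y s)

/-- The vectors of relative positions whose rigid part lies in `K` and whose satellite blocks have
the prescribed lengths. -/
def satelliteCircles (d : E ⊕ W → ℝ) (K : Set (Stacked E)) : Set (Stacked (E ⊕ W)) :=
  {z | rigidPart z ∈ K ∧ ∀ s, ‖block z (Sum.inr s)‖ = d (Sum.inr s)}

/-- Satellites are leaves of the graph, so turning the rigid edges together through `u * φ` and each
satellite edge through its own `u * ψ s` always leaves a realizable vector. -/
theorem satelliteCircles_subset_ambit (G : OrientedGraph V E) (a : W → V) {d : E ⊕ W → ℝ}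
    {q : Stacked (V ⊕ W)}
    (hq : ∀ s, ‖block ((G.withSatellites a).relPos q) (Sum.inr s)‖ = d (Sum.inr s)) :
    satelliteCircles d (orbit (G.relPos (rigidPart q))) ⊆ (G.withSatellites a).ambit q := by
  rintro z ⟨hz, hzs⟩
  obtain ⟨φ, hφ⟩ := mem_orbit.1 hz
  have hs : ∀ s, ∃ ψ, rotate (rot ψ : Matrix (Fin 2) (Fin 2) ℝ)
      (block ((G.withSatellites a).relPos q) (Sum.inr s)) = block z (Sum.inr s) := fun s =>
    exists_rotate_eq ((hq s).trans (hzs s).symm)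
  choose ψ hψ using hs
  refine ⟨fun u => Sum.elim (fun _ => rot (u * φ)) fun s => rot (u * ψ s), ?_, ?_, fun u => ?_, ?_⟩
  · refine continuous_pi fun k => ?_
    rcases k with k | s
    · exact continuous_rot.comp (by fun_prop)
    · exact continuous_rot.comp (by fun_prop)
  · funext k
    rcases k with k | s <;> simp [rot_zero]
  · refine ⟨attach a (rotatePlacement (u * φ) (rigidPart q)) fun s =>
      rotate (rot (u * ψ s) : Matrix (Fin 2) (Fin 2) ℝ)
        (block ((G.withSatellites a).relPos q) (Sum.inr s)), stacked_ext fun k => ?_⟩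
    rcases k with k | s
    · rw [← block_rigidPart, rigidPart_relPos, rigidPart_attach, block_relPos_rotatePlacement,
        ← G.rigidPart_relPos a]
      rfl
    · rw [block_relPos_attach_inr]
      rfl
  · refine stacked_ext fun k => ?_
    rw [block_rotateBlocks]
    rcases k with k | s
    · rw [← block_rigidPart, hφ, ← G.rigidPart_relPos a]
      simp [block_rigidPart]
    · rw [← hψ]
      simp

/-- Along an admissible path the parameters at which the rigid part lies in the orbit form a closed
set, since the orbit is compact, and an open one, by local uniqueness at constant edge lengths. The
unit interval is connected. -/
theorem ambit_subset_satelliteCircles {G : OrientedGraph V E} {a : W → V} {d : E ⊕ W → ℝ}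
    (hcard : Fintype.card E + 3 = 2 * Fintype.card V) {q : Stacked (V ⊕ W)}
    (hI : G.IndepAt (G.relPos (rigidPart q)))
    (hq : ∀ s, ‖block ((G.withSatellites a).relPos q) (Sum.inr s)‖ = d (Sum.inr s)) :
    (G.withSatellites a).ambit q ⊆ satelliteCircles d (orbit (G.relPos (rigidPart q))) := by
  rintro z ⟨T, hT, hT0, hTr, rfl⟩
  refine ⟨?_, fun s => by rw [block_rotateBlocks, norm_rotate, hq]⟩
  set O := orbit (G.relPos (rigidPart q)) with hO
  set y : unitInterval → Stacked E := fun u =>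
    rigidPart (rotateBlocks (T u) ((G.withSatellites a).relPos q)) with hy
  have hyc : Continuous y := continuous_stacked fun k =>
    continuous_rotate (v := fun _ => block ((G.withSatellites a).relPos q) (Sum.inl k))
      (continuous_subtype_val.comp ((continuous_apply (Sum.inl k)).comp hT)) continuous_const
  have hyr : ∀ u, y u ∈ Set.range G.relPos := fun u => by
    obtain ⟨p, hp⟩ := hTr u
    exact ⟨rigidPart p, by rw [← G.rigidPart_relPos a, hp]⟩
  have hyn : ∀ u k, ‖block (y u) k‖ = ‖block (G.relPos (rigidPart q)) k‖ := fun u k => by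
    rw [hy, ← G.rigidPart_relPos a, block_rigidPart, block_rotateBlocks, norm_rotate,
      block_rigidPart]
  obtain ⟨b, hb, hloc⟩ := exists_forall_mem_orbit hcard (isCompact_orbit _)
    ⟨_, self_mem_orbit _⟩ (G.orbit_relPos_subset_range (rigidPart q))
    fun z hz => hI.of_mem_orbit hz
  have hpre : y ⁻¹' O = y ⁻¹' Metric.thickening b O := by
    refine Set.Subset.antisymm (Set.preimage_mono (Metric.self_subset_thickening hb O)) ?_
    intro u hu
    obtain ⟨z, hz, hdist⟩ := Metric.mem_thickening_iff.1 hu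
    exact orbit_trans (hloc _ (hyr u) z hz hdist fun k => by
      rw [hyn, norm_block_of_mem_orbit hz]) hz
  have hclopen : IsClopen (y ⁻¹' O) :=
    ⟨(isCompact_orbit _).isClosed.preimage hyc, hpre ▸ Metric.isOpen_thickening.preimage hyc⟩
  have huniv := hclopen.eq_univ ⟨0, by
    rw [Set.mem_preimage, hy]
    dsimp only
    rw [hT0]
    convert self_mem_orbit (G.relPos (rigidPart q)) using 1
    refine stacked_ext fun k => ?_
    rw [block_rigidPart, block_rotateBlocks, ← G.rigidPart_relPos a]
    exact rotate_one _⟩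
  have h1 : (1 : unitInterval) ∈ y ⁻¹' O := by
    rw [huniv]
    trivial
  exact h1

end OrientedGraph

/-! ### The deviation from a set of shapes -/

theorem distErr_apply {ι : Type*} (d : ι → ℝ) (z : Stacked ι) (k : ι) :
    distErr d z k = ‖block z k‖ ^ 2 - d k ^ 2 := rfl

theorem continuous_distErr {ι : Type*} [Fintype ι] (d : ι → ℝ) :
    Continuous (distErr d : Stacked ι → EuclideanSpace ℝ ι) :=
  (PiLp.continuous_toLp 2 _).comp
    (continuous_pi fun k => ((continuous_block k).norm.pow 2).sub continuous_const)

theorem distErr_eq_zero_iff {ι : Type*} {d : ι → ℝ} (hd : ∀ k, 0 < d k) {z : Stacked ι} :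
    distErr d z = 0 ↔ ∀ k, ‖block z k‖ = d k := by
  constructor
  · intro h k
    have := congrArg (fun x => x.ofLp k) h
    simp only [distErr_apply, PiLp.zero_apply, sub_eq_zero] at this
    exact (pow_left_inj₀ (norm_nonneg _) (hd k).le two_ne_zero).1 this
  · intro h
    ext k
    simp [distErr_apply, h]

theorem isBounded_norm_distErr_le {ι : Type*} [Fintype ι] (d : ι → ℝ) (b : ℝ) :
    Bornology.IsBounded {z : Stacked ι | ‖distErr d z‖ ≤ b} := by
  rw [isBounded_iff_forall_norm_le]
  refine ⟨∑ k, (d k ^ 2 + b + 1), fun z hz => (norm_le_sum_block z).trans ?_⟩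
  refine Finset.sum_le_sum fun k _ => ?_
  have h1 : ‖block z k‖ ^ 2 - d k ^ 2 ≤ b :=
    (le_abs_self _).trans ((PiLp.norm_apply_le (distErr d z) k).trans hz)
  nlinarith [norm_nonneg (block z k)]

namespace OrientedGraph

variable {V E W : Type*} [Fintype V] [Fintype E] [Fintype W] [DecidableEq V] [DecidableEq E]
  [DecidableEq W]

/-- How far a vector of relative positions is from having its rigid part in `K` and the prescribed
edge lengths. -/
noncomputable def deviation (d : E ⊕ W → ℝ) (K : Set (Stacked E)) (z : Stacked (E ⊕ W)) : ℝ :=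
  max (Metric.infDist (rigidPart z) K) ‖distErr d z‖

theorem continuous_deviation (d : E ⊕ W → ℝ) (K : Set (Stacked E)) : Continuous (deviation d K) :=
  ((Metric.continuous_infDist_pt K).comp continuous_rigidPart).max (continuous_distErr d).norm

theorem isCompact_deviation_le (d : E ⊕ W → ℝ) (K : Set (Stacked E)) (b : ℝ) :
    IsCompact {z | deviation d K z ≤ b} :=
  Metric.isCompact_of_isClosed_isBounded
    (isClosed_le (continuous_deviation d K) continuous_const)
    ((isBounded_norm_distErr_le d b).subset fun z (hz : deviation d K z ≤ b) =>
      show ‖distErr d z‖ ≤ b from (le_max_right _ _).trans hz)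

theorem deviation_le_zero_iff {d : E ⊕ W → ℝ} (hd : ∀ k, 0 < d k) {K : Set (Stacked E)}
    (hK : IsCompact K) (hne : K.Nonempty) {z : Stacked (E ⊕ W)} :
    deviation d K z ≤ 0 ↔ rigidPart z ∈ K ∧ ∀ k, ‖block z k‖ = d k := by
  rw [deviation, max_le_iff, norm_le_zero_iff, distErr_eq_zero_iff hd,
    hK.isClosed.mem_iff_infDist_zero hne]
  exact and_congr_left' ⟨fun h => le_antisymm h Metric.infDist_nonneg, fun h => h.le⟩

theorem deviation_le_zero_iff_mem {d : E ⊕ W → ℝ} (hd : ∀ k, 0 < d k) {K : Set (Stacked E)}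
    (hK : IsCompact K) (hne : K.Nonempty) (hKd : ∀ z ∈ K, ∀ k, ‖block z k‖ = d (Sum.inl k))
    {z : Stacked (E ⊕ W)} :
    deviation d K z ≤ 0 ↔ z ∈ satelliteCircles d K := by
  rw [deviation_le_zero_iff hd hK hne]
  refine and_congr_right fun hz => ⟨fun h s => h _, fun h k => ?_⟩
  rcases k with k | s
  · exact hKd _ hz k
  · exact h s

/-- This and `exists_deviation_lt_of_infDist` allow the distance to the ambit to be exchanged for
`deviation`, which the estimates control directly and which does not involve the angles of the
satellites. -/
theorem exists_infDist_lt_of_deviation {d : E ⊕ W → ℝ} (hd : ∀ k, 0 < d k) {K : Set (Stacked E)}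
    (hK : IsCompact K) (hne : K.Nonempty) {A : Set (Stacked (E ⊕ W))}
    (hA : satelliteCircles d K ⊆ A) {ε : ℝ} (hε : 0 < ε) :
    ∃ b, 0 < b ∧ ∀ z, deviation d K z ≤ b → Metric.infDist z A < ε := by
  obtain ⟨b, hb, -, h⟩ := exists_sublevel_subset (continuous_deviation d K)
    (isCompact_deviation_le d K 1)
    (isOpen_lt (Metric.continuous_infDist_pt A) (continuous_const (y := ε))) (fun z hz => by
      obtain ⟨h1, h2⟩ := (deviation_le_zero_iff hd hK hne).1 hz
      have hzA : z ∈ A := hA ⟨h1, fun s => h2 _⟩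
      show Metric.infDist z A < ε
      rwa [Metric.infDist_zero_of_mem hzA])
  exact ⟨b, hb, fun z hz => h hz⟩

theorem exists_deviation_lt_of_infDist {d : E ⊕ W → ℝ} (hd : ∀ k, 0 < d k) {K : Set (Stacked E)}
    (hK : IsCompact K) (hne : K.Nonempty) (hKd : ∀ z ∈ K, ∀ k, ‖block z k‖ = d (Sum.inl k))
    (hA : (satelliteCircles d K).Nonempty) {ε : ℝ} (hε : 0 < ε) :
    ∃ b, 0 < b ∧ ∀ z, Metric.infDist z (satelliteCircles d K) < b → deviation d K z < ε := by
  have hset : satelliteCircles d K = {z | deviation d K z ≤ 0} :=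
    Set.ext fun z => (deviation_le_zero_iff_mem hd hK hne hKd).symm
  have hcomp : IsCompact (satelliteCircles d K) := hset ▸ isCompact_deviation_le d K 0
  obtain ⟨b, hb, h⟩ := hcomp.exists_thickening_subset_open
    (isOpen_lt (continuous_deviation d K) (continuous_const (y := ε))) (fun z hz => by
      rw [hset] at hz
      exact lt_of_le_of_lt hz hε)
  exact ⟨b, hb, fun z hz => h ((Metric.mem_thickening_iff_infDist_lt hA).2 hz)⟩

/-! ### Estimates along the closed loop -/

variable (G : OrientedGraph V E) (a : W → V) (d : E ⊕ W → ℝ)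

/-- The vector of relative positions in the graph with satellites. -/
noncomputable abbrev fullPos (p : Stacked (V ⊕ W)) : Stacked (E ⊕ W) :=
  (G.withSatellites a).relPos p

/-- The vector `R(z)ᵀ e` at a placement. -/
noncomputable abbrev errForce (p : Stacked (V ⊕ W)) : Stacked (V ⊕ W) :=
  (G.withSatellites a).force (G.fullPos a p) (distErr d (G.fullPos a p))

theorem rigidPart_closedLoop (p : Stacked (V ⊕ W)) :
    rigidPart (G.closedLoop a d p) = -rigidPart (G.errForce a d p) :=
  stacked_ext fun i => by
    rw [block_rigidPart, block_closedLoop_inl]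
    rfl

/-- The factor 4 combines a 2 from `e_k²` with a 2 from `‖z_k‖²`; the energy identity removes the
spin. -/
theorem hasDerivWithinAt_norm_distErr_sq {p : ℝ → Stacked (V ⊕ W)} {s : Set ℝ} {t : ℝ}
    (hp : HasDerivWithinAt p (G.closedLoop a d (p t)) s t) :
    HasDerivWithinAt (fun u => ‖distErr d (G.fullPos a (p u))‖ ^ 2)
      (-(4 * ‖G.errForce a d (p t)‖ ^ 2)) s t := by
  have hz : ∀ k, HasDerivWithinAt (fun u => block (G.fullPos a (p u)) k)
      (block (G.fullPos a (G.closedLoop a d (p t))) k) s t := fun k =>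
    (blockₗ k ∘ₗ (G.withSatellites a).relPosₗ).comp_hasDerivWithinAt hp
  have he : ∀ k, HasDerivWithinAt (fun u => distErr d (G.fullPos a (p u)) k ^ 2)
      (2 * distErr d (G.fullPos a (p t)) k * (2 * inner ℝ (block (G.fullPos a (p t)) k)
        (block (G.fullPos a (G.closedLoop a d (p t))) k))) s t := fun k => by
    have := ((hz k).norm_sq.sub_const (d k ^ 2)).fun_pow 2
    refine this.congr_deriv ?_
    simp [distErr_apply]
  have hsum := HasDerivWithinAt.fun_sum (u := Finset.univ) fun k _ => he k
  have heq : ∀ u, ‖distErr d (G.fullPos a (p u))‖ ^ 2 =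
      ∑ k, distErr d (G.fullPos a (p u)) k ^ 2 := fun u => EuclideanSpace.real_norm_sq_eq _
  simp only [heq]
  refine hsum.congr_deriv ?_
  rw [← mul_neg, ← inner_force_closedLoop, inner_force, Finset.mul_sum]
  exact Finset.sum_congr rfl fun k _ => by ring

theorem norm_distErr_le_mul_exp {p : ℝ → Stacked (V ⊕ W)} {T lam : ℝ} (hT : 0 ≤ T)
    (hlam : 0 ≤ lam) (hpc : ContinuousOn p (Set.Icc 0 T))
    (hp : ∀ t ∈ Set.Ico 0 T, HasDerivWithinAt p (G.closedLoop a d (p t)) (Set.Ici t) t)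
    (hlow : ∀ t ∈ Set.Ico 0 T,
      lam * ‖distErr d (G.fullPos a (p t))‖ ≤ ‖G.errForce a d (p t)‖) :
    ‖distErr d (G.fullPos a (p T))‖ ≤
      ‖distErr d (G.fullPos a (p 0))‖ * Real.exp (-(2 * lam ^ 2 * T)) := by
  have hcont : Continuous fun q : Stacked (V ⊕ W) => ‖distErr d (G.fullPos a q)‖ ^ 2 :=
    (((continuous_distErr d).comp (continuous_relPos _)).norm).pow 2
  -- The squared norm decays at rate `4 * lam ^ 2`, hence the norm at half that rate.
  have := le_mul_exp_of_deriv_le (c := 4 * lam ^ 2) hT (hcont.comp_continuousOn hpc)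
    (fun t ht => G.hasDerivWithinAt_norm_distErr_sq a d (hp t ht)) (fun t ht => by
      have h1 := pow_le_pow_left₀ (by positivity) (hlow t ht) 2
      simp only [Function.comp_apply]
      nlinarith)
  refine (pow_le_pow_iff_left₀ (norm_nonneg _) (by positivity) two_ne_zero).1 ?_
  rw [mul_pow, ← Real.exp_nat_mul]
  refine this.trans_eq ?_
  simp only [Function.comp_apply]
  congr 2
  push_cast
  ring

theorem norm_rigidPart_sub_le {p : ℝ → Stacked (V ⊕ W)} {s T A r : ℝ} (hr : 0 < r) (hA : 0 ≤ A)
    (hsT : s ≤ T) (hpc : ContinuousOn p (Set.Icc s T))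
    (hp : ∀ t ∈ Set.Ico s T, HasDerivWithinAt p (G.closedLoop a d (p t)) (Set.Ici t) t)
    (hb : ∀ t ∈ Set.Ico s T, ‖G.errForce a d (p t)‖ ≤ A * Real.exp (-(r * t))) :
    ‖rigidPart (p T) - rigidPart (p s)‖ ≤ A / r * Real.exp (-(r * s)) := by
  refine norm_sub_le_of_norm_deriv_le_exp (f := fun t => rigidPart (p t)) hr hA hsT
    (continuous_rigidPart.comp_continuousOn hpc)
    (fun t ht => rigidPartₗ.comp_hasDerivWithinAt (hp t ht)) fun t ht => ?_
  change ‖rigidPart (G.closedLoop a d (p t))‖ ≤ _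
  rw [rigidPart_closedLoop, norm_neg]
  exact (norm_rigidPart_le _).trans (hb t ht)

variable {d}

/-- Solutions that start close to the set of shapes are trapped near it. The hypothesis on `p` asks
for the differential equation only while `p` is near that set. -/
theorem exists_trapping (hd : ∀ k, 0 < d k) {K : Set (Stacked E)} (hK : IsCompact K)
    (hne : K.Nonempty) (hI : ∀ z ∈ K, G.IndepAt z) :
    ∃ b, 0 < b ∧ ∃ r, 0 < r ∧ ∃ M, 0 < M ∧ ∀ ε, 0 < ε → ε ≤ b → ∃ δ, 0 < δ ∧
      ∀ p : ℝ → Stacked (V ⊕ W), ContinuousOn p (Set.Ici 0) →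
      deviation d K (G.fullPos a (p 0)) < δ →
      (∀ t, 0 ≤ t → deviation d K (G.fullPos a (p t)) < b →
        ‖rigidPart (p t) - rigidPart (p 0)‖ < b →
        HasDerivWithinAt p (G.closedLoop a d (p t)) (Set.Ici 0) t) →
      ∀ t, 0 ≤ t → deviation d K (G.fullPos a (p t)) < ε ∧
        ‖rigidPart (p t) - rigidPart (p 0)‖ < ε ∧
        ‖distErr d (G.fullPos a (p t))‖ ≤
          ‖distErr d (G.fullPos a (p 0))‖ * Real.exp (-(r * t)) ∧
        ‖G.errForce a d (p t)‖ ≤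
          M * ‖distErr d (G.fullPos a (p 0))‖ * Real.exp (-(r * t)) := by
  obtain ⟨b, hb, hb1, lam, hlam, hlow⟩ := exists_lower_bound_of_injective
    (continuous_deviation d K) (isCompact_deviation_le d K 1)
    (G.withSatellites a).continuous_force (G.withSatellites a).force_smul (fun z hz => by
      obtain ⟨h1, h2⟩ := (deviation_le_zero_iff hd hK hne).1 hz
      exact indepAt_withSatellites (hI _ h1) fun s => by
        rw [← norm_pos_iff, h2]
        exact hd _)
  obtain ⟨M, hM, hup⟩ := exists_upper_bound_of_homogeneous (isCompact_deviation_le d K b)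
    (G.withSatellites a).continuous_force (G.withSatellites a).force_smul
  obtain ⟨L, hL, hLb⟩ := G.relPosₗ.toContinuousLinearMap.bound
  have hLb : ∀ x y, ‖G.relPos x - G.relPos y‖ ≤ L * ‖x - y‖ := fun x y => by
    rw [← relPos_sub]; exact hLb _
  have hr : 0 < 2 * lam ^ 2 := by positivity
  refine ⟨b, hb, 2 * lam ^ 2, hr, M, hM, fun ε hε hεb => ?_⟩
  set r := 2 * lam ^ 2
  have hden : 0 < 1 + (1 + L) * (M / r) := by positivity
  -- Room for the initial deviation `δ` and for a displacement `M / r * δ` of the rigid agents,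
  -- counted once for their placement and `L` times for their relative positions.
  set δ := ε / (1 + (1 + L) * (M / r)) with hδ
  have hδ0 : 0 < δ := by positivity
  have hδε : δ + (1 + L) * (M / r * δ) = ε := by
    rw [hδ]; field_simp
  refine ⟨δ, hδ0, fun p hpc hp0 hp => ?_⟩
  set g : ℝ → ℝ := fun t => max (deviation d K (G.fullPos a (p t)))
    ‖rigidPart (p t) - rigidPart (p 0)‖ with hg
  set e₀ := ‖distErr d (G.fullPos a (p 0))‖ with he₀
  have he0 : e₀ < δ := (le_max_right _ _).trans_lt hp0
  have hgc : ContinuousOn g (Set.Ici 0) := by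
    refine ContinuousOn.sup ?_ ?_
    · exact ((continuous_deviation d K).comp (continuous_relPos _)).comp_continuousOn hpc
    · exact ((continuous_rigidPart.comp_continuousOn hpc).sub continuousOn_const).norm
  have hderiv : ∀ t, 0 ≤ t → g t < ε →
      HasDerivWithinAt p (G.closedLoop a d (p t)) (Set.Ici t) t := fun t ht hgt =>
    (hp t ht (((le_max_left _ _).trans_lt hgt).trans_le hεb)
      (((le_max_right _ _).trans_lt hgt).trans_le hεb)).mono fun u hu => le_trans ht hu
  have herr : ∀ T, 0 ≤ T → (∀ t ∈ Set.Ico 0 T, g t < ε) →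
      ‖distErr d (G.fullPos a (p T))‖ ≤ e₀ * Real.exp (-(r * T)) := fun T hT hgT =>
    G.norm_distErr_le_mul_exp a d hT hlam.le (hpc.mono Set.Icc_subset_Ici_self)
      (fun t ht => hderiv t ht.1 (hgT t ht))
      (fun t ht => hlow _ (((le_max_left _ _).trans (hgT t ht).le).trans hεb) _)
  have hforce : ∀ T, 0 ≤ T → (∀ t ∈ Set.Ico 0 T, g t < ε) → g T < ε →
      ‖G.errForce a d (p T)‖ ≤ M * e₀ * Real.exp (-(r * T)) := fun T hT hgT hT' => by
    refine (hup _ (((le_max_left _ _).trans hT'.le).trans hεb) _).trans ?_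
    rw [mul_assoc]
    exact mul_le_mul_of_nonneg_left (herr T hT hgT) hM.le
  have htrap : ∀ t, 0 ≤ t → g t < ε := by
    -- While the motion stays within `ε`, the decay estimates hold and bound both the errors and the
    -- displacement strictly below `ε` at the next instant too.
    refine forall_lt_of_bootstrap hgc fun T hT hgT => ?_
    have hmove : ‖rigidPart (p T) - rigidPart (p 0)‖ ≤ M / r * δ := by
      have := G.norm_rigidPart_sub_le a d (A := M * e₀) hr (by positivity) hT
        (hpc.mono Set.Icc_subset_Ici_self) (fun t ht => hderiv t ht.1 (hgT t ht)) fun t ht =>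
          hforce t ht.1 (fun u hu => hgT u ⟨hu.1, hu.2.trans ht.2⟩) (hgT t ht)
      rw [mul_zero, neg_zero, Real.exp_zero, mul_one, mul_div_right_comm] at this
      exact this.trans (by gcongr)
    have hMr : 0 < M / r * δ := by positivity
    have hLMr : 0 ≤ L * (M / r * δ) := by positivity
    refine max_lt (max_lt ?_ ?_) ?_
    · rw [rigidPart_relPos]
      have h1 := Metric.infDist_le_infDist_add_dist (s := K) (x := G.relPos (rigidPart (p T)))
        (y := G.relPos (rigidPart (p 0)))
      rw [dist_eq_norm] at h1
      have h2 := hLb (rigidPart (p T)) (rigidPart (p 0))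
      have h3 := mul_le_mul_of_nonneg_left hmove hL.le
      have h4 := (le_max_left _ _).trans_lt hp0
      rw [rigidPart_relPos] at h4
      linarith
    · have h1 := herr T hT hgT
      have h2 : Real.exp (-(r * T)) ≤ 1 := Real.exp_le_one_iff.2 (by
        have := mul_nonneg hr.le hT
        linarith)
      have h3 : e₀ * Real.exp (-(r * T)) ≤ e₀ := mul_le_of_le_one_right (norm_nonneg _) h2
      linarith
    · linarith
  intro t ht
  exact ⟨(le_max_left _ _).trans_lt (htrap t ht), (le_max_right _ _).trans_lt (htrap t ht),
    herr t ht fun u hu => htrap u hu.1, hforce t ht (fun u hu => htrap u hu.1) (htrap t ht)⟩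

/-! ### Existence of solutions -/

theorem contDiff_closedLoop : ContDiff ℝ 1 (G.closedLoop a d) := by
  have hz : ∀ kc : (E ⊕ W) × Fin 2, ContDiff ℝ 1 fun p => G.fullPos a p kc := fun kc =>
    (EuclideanSpace.proj (𝕜 := ℝ) kc ∘L
      (G.withSatellites a).relPosₗ.toContinuousLinearMap).contDiff
  have he : ∀ k, ContDiff ℝ 1 fun p => distErr d (G.fullPos a p) k := fun k => by
    simp only [distErr_apply, norm_sq_fin_two, block_apply]
    have h0 := hz (k, 0)
    have h1 := hz (k, 1)
    fun_prop
  have hforce : ∀ ic, ContDiff ℝ 1 fun p => G.errForce a d p ic := fun ic => by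
    have : ∀ p, G.errForce a d p ic = ∑ k, ((G.withSatellites a).incidence ic.1 k *
        distErr d (G.fullPos a p) k) * G.fullPos a p (k, ic.2) := fun p => by
      rw [← block_apply, block_force]
      simp
    simp only [this]
    exact ContDiff.sum fun k _ => (contDiff_const.mul (he k)).mul (hz _)
  have hperp : ∀ s, ∀ c : Fin 2,
      ContDiff ℝ 1 fun p => cw (block (G.fullPos a p) (Sum.inr s)) c := fun s c => by
    fin_cases c
    · exact hz (Sum.inr s, 1)
    · exact (hz (Sum.inr s, 0)).neg
  rw [contDiff_euclidean]
  rintro ⟨i | s, c⟩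
  · have : ∀ p, G.closedLoop a d p (Sum.inl i, c) = -G.errForce a d p (Sum.inl i, c) := fun p =>
      congrArg (fun v => v.ofLp c) (G.block_closedLoop_inl a d p i)
    simp only [this]
    exact (hforce _).neg
  · have : ∀ p, G.closedLoop a d p (Sum.inr s, c) = -(distErr d (G.fullPos a p) (Sum.inr s) *
        G.fullPos a p (Sum.inr s, c)) + cw (block (G.fullPos a p) (Sum.inr s)) c := fun p =>
      congrArg (fun v => v.ofLp c) (G.block_closedLoop_inr a d p s)
    simp only [this]
    exact ((he _).mul (hz _)).neg.add (hperp s c)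

/-- The deviation is blind to translations, so the rigid agents need a bound of their own; the
bounded errors then confine the satellites. -/
theorem isBounded_of_deviation_lt (K : Set (Stacked E)) (x₀ : Stacked V) (b : ℝ) :
    Bornology.IsBounded {p : Stacked (V ⊕ W) | deviation d K (G.fullPos a p) < b ∧
      ‖rigidPart p - x₀‖ < b} := by
  obtain ⟨C, hC⟩ := isBounded_iff_forall_norm_le.1 (isBounded_norm_distErr_le d b)
  rw [isBounded_iff_forall_norm_le]
  refine ⟨∑ _i : V, (‖x₀‖ + b) + ∑ _s : W, (C + (‖x₀‖ + b)), fun p ⟨h1, h2⟩ => ?_⟩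
  have hV : ∀ i, ‖block p (Sum.inl i)‖ ≤ ‖x₀‖ + b := fun i => by
    rw [← block_rigidPart]
    refine (norm_block_le _ i).trans ?_
    have := norm_add_le (rigidPart p - x₀) x₀
    rw [sub_add_cancel] at this
    linarith
  refine (norm_le_sum_block p).trans ?_
  rw [Fintype.sum_sum_type]
  refine add_le_add (Finset.sum_le_sum fun i _ => hV i) (Finset.sum_le_sum fun s _ => ?_)
  have h3 := (norm_block_le _ (Sum.inr s)).trans (hC (G.fullPos a p) ((le_max_right _ _).trans h1.le))
  rw [block_relPos_inr] at h3
  have h4 := norm_add_le (block p (Sum.inr s) - block p (Sum.inl (a s))) (block p (Sum.inl (a s)))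
  rw [sub_add_cancel] at h4
  linarith [hV (a s)]

/-- The field is cut off by a bump equal to 1 on the bounded trapping region. The result is bounded
and Lipschitz, so it has a global solution; trapping shows that this solution never meets the
cut-off. This is why `htrap` must not assume the differential equation everywhere. -/
theorem exists_solution_of_trapping {K : Set (Stacked E)} {b : ℝ} {p₀ : Stacked (V ⊕ W)}
    (htrap : ∀ p : ℝ → Stacked (V ⊕ W), ContinuousOn p (Set.Ici 0) → p 0 = p₀ →
      (∀ t, 0 ≤ t → deviation d K (G.fullPos a (p t)) < b →
        ‖rigidPart (p t) - rigidPart (p 0)‖ < b →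
        HasDerivWithinAt p (G.closedLoop a d (p t)) (Set.Ici 0) t) →
      ∀ t, 0 ≤ t → deviation d K (G.fullPos a (p t)) < b ∧
        ‖rigidPart (p t) - rigidPart (p 0)‖ < b) :
    ∃ p, G.IsSolution a d p₀ p := by
  obtain ⟨R, hR⟩ := isBounded_iff_forall_norm_le.1
    (G.isBounded_of_deviation_lt a (d := d) K (rigidPart p₀) b)
  let χ : ContDiffBump (0 : Stacked (V ⊕ W)) := ⟨max R 1, max R 1 + 1, by positivity, by linarith⟩
  set f : Stacked (V ⊕ W) → Stacked (V ⊕ W) := fun p => χ p • G.closedLoop a d p with hf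
  have hfs : HasCompactSupport f := χ.hasCompactSupport.smul_right
  have hfc : ContDiff ℝ 1 f := χ.contDiff.smul (G.contDiff_closedLoop a)
  obtain ⟨C, hC⟩ := hfc.lipschitzWith_of_hasCompactSupport hfs one_ne_zero
  obtain ⟨B, hB⟩ := hfs.exists_bound_of_continuous hfc.continuous
  obtain ⟨p, hp0, hp⟩ := exists_solution_Ici_of_lipschitzWith hC
    (L := ⟨max B 0, le_max_right _ _⟩) (fun x => (hB x).trans (le_max_left _ _)) p₀
  have hgood : ∀ t, 0 ≤ t → deviation d K (G.fullPos a (p t)) < b →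
      ‖rigidPart (p t) - rigidPart (p 0)‖ < b →
      HasDerivWithinAt p (G.closedLoop a d (p t)) (Set.Ici 0) t := fun t ht h1 h2 => by
    have h := hp t ht
    rw [hp0] at h2
    have hχ : χ (p t) = 1 := χ.one_of_mem_closedBall (by
      rw [mem_closedBall_zero_iff]
      exact (hR _ ⟨h1, h2⟩).trans (le_max_left _ _))
    simpa only [hf, hχ, one_smul] using h
  have hall := htrap p (fun t ht => (hp t ht).continuousWithinAt) hp0 hgood
  exact ⟨p, hp0, fun t ht => hgood t ht (hall t ht).1 (hall t ht).2⟩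

end OrientedGraph

/-! ### Convergence of the satellites -/

/-- The clockwise quarter turn as a linear map. -/
noncomputable def cwₗ : EuclideanSpace ℝ (Fin 2) →ₗ[ℝ] EuclideanSpace ℝ (Fin 2) where
  toFun := cw
  map_add' v w := by apply plane_ext <;> simp [cw]; ring
  map_smul' c v := by apply plane_ext <;> simp [cw]

theorem rotate_rot_eq (φ : ℝ) (v : EuclideanSpace ℝ (Fin 2)) :
    rotate (rot φ : Matrix (Fin 2) (Fin 2) ℝ) v = Real.cos φ • v - Real.sin φ • cwₗ v := by
  apply plane_ext
  · rw [rotate_rot_zero]; simp [cwₗ, cw]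
  · rw [rotate_rot_one]; simp [cwₗ, cw]; ring

/-- The counterclockwise `rot u` undoes a uniform clockwise rotation, so only the defect `v' - cw v`
remains. -/
theorem hasDerivWithinAt_rotate_rot {v : ℝ → EuclideanSpace ℝ (Fin 2)}
    {v' : EuclideanSpace ℝ (Fin 2)} {s : Set ℝ} {t : ℝ} (hv : HasDerivWithinAt v v' s t) :
    HasDerivWithinAt (fun u => rotate (rot u : Matrix (Fin 2) (Fin 2) ℝ) (v u))
      (rotate (rot t : Matrix (Fin 2) (Fin 2) ℝ) (v' - cw (v t))) s t := by
  simp only [rotate_rot_eq]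
  refine (((Real.hasDerivAt_cos t).hasDerivWithinAt.smul hv).sub
    ((Real.hasDerivAt_sin t).hasDerivWithinAt.smul (cwₗ.comp_hasDerivWithinAt hv))).congr_deriv ?_
  apply plane_ext <;> simp [cwₗ, cw] <;> ring

theorem tendsto_mul_exp_neg {r : ℝ} (hr : 0 < r) (A : ℝ) :
    Tendsto (fun t => A * Real.exp (-(r * t))) atTop (𝓝 0) := by
  have : Tendsto (fun t => Real.exp (-(r * t))) atTop (𝓝 0) :=
    Real.tendsto_exp_neg_atTop_nhds_zero.comp (tendsto_id.const_mul_atTop hr)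
  simpa using this.const_mul A

/-- A planar vector of asymptotically constant length whose velocity approaches its clockwise
quarter turn exponentially fast has an asymptotic phase. -/
theorem exists_phase {v v' : ℝ → EuclideanSpace ℝ (Fin 2)} {A r ρ : ℝ} (hr : 0 < r) (hA : 0 ≤ A)
    (hv : ∀ t, 0 ≤ t → HasDerivWithinAt v (v' t) (Set.Ici 0) t)
    (hb : ∀ t, 0 ≤ t → ‖v' t - cw (v t)‖ ≤ A * Real.exp (-(r * t)))
    (hρ : 0 ≤ ρ) (hlim : Tendsto (fun t => ‖v t‖) atTop (𝓝 ρ)) :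
    ∃ θ : ℝ, Tendsto (fun t => v t - ρ • !₂[Real.cos (θ - t), Real.sin (θ - t)]) atTop (𝓝 0) := by
  obtain ⟨w, hw⟩ := exists_tendsto_of_norm_deriv_le_exp hr hA
    (fun t ht => hasDerivWithinAt_rotate_rot (hv t ht))
    (fun t ht => by rw [norm_rotate]; exact hb t ht)
  have hwn : ‖w‖ = ρ := tendsto_nhds_unique (hw.norm) (by simpa only [norm_rotate] using hlim)
  -- The phase is the polar angle of the limit `w` in the turning frame.
  obtain ⟨θ, hθ⟩ := exists_rotate_eq (u := !₂[ρ, 0]) (v := w) (by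
    rw [hwn, EuclideanSpace.norm_eq]
    simp [Fin.sum_univ_two, Real.sqrt_sq hρ])
  refine ⟨θ, ?_⟩
  rw [tendsto_zero_iff_norm_tendsto_zero]
  have hconv := (hw.sub_const w).norm
  rw [sub_self, norm_zero] at hconv
  refine hconv.congr fun t => ?_
  rw [← norm_rotate (rot t) (v t - _), rotate_sub]
  congr 2
  rw [← hθ]
  apply plane_ext
  · simp only [rotate_rot_zero, PiLp.smul_apply, smul_eq_mul, Real.cos_sub, Real.sin_sub]
    simp
    linear_combination (-ρ * Real.cos θ) * Real.sin_sq_add_cos_sq t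
  · simp only [rotate_rot_one, PiLp.smul_apply, smul_eq_mul, Real.cos_sub, Real.sin_sub]
    simp
    linear_combination (-ρ * Real.sin θ) * Real.sin_sq_add_cos_sq t

namespace OrientedGraph

variable {V E W : Type*} [Fintype V] [Fintype E] [Fintype W] [DecidableEq V] [DecidableEq E]
  [DecidableEq W] {G : OrientedGraph V E} {a : W → V} {d : E ⊕ W → ℝ}

theorem exists_tendsto_rigidPart {p : ℝ → Stacked (V ⊕ W)} {A r : ℝ} (hr : 0 < r) (hA : 0 ≤ A)
    (hp : ∀ t, 0 ≤ t → HasDerivWithinAt p (G.closedLoop a d (p t)) (Set.Ici 0) t)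
    (hF : ∀ t, 0 ≤ t → ‖G.errForce a d (p t)‖ ≤ A * Real.exp (-(r * t))) :
    ∃ c, Tendsto (fun t => rigidPart (p t)) atTop (𝓝 c) :=
  exists_tendsto_of_norm_deriv_le_exp hr hA
    (fun t ht => rigidPartₗ.comp_hasDerivWithinAt (hp t ht)) fun t ht => by
      change ‖rigidPart (G.closedLoop a d (p t))‖ ≤ _
      rw [rigidPart_closedLoop, norm_neg]
      exact (norm_rigidPart_le _).trans (hF t ht)

theorem convergesToAmbit_of_tendsto (hd : ∀ k, 0 < d k) {p : ℝ → Stacked (V ⊕ W)} {A r : ℝ}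
    (hr : 0 < r) (hA : 0 ≤ A)
    (hp : ∀ t, 0 ≤ t → HasDerivWithinAt p (G.closedLoop a d (p t)) (Set.Ici 0) t)
    (he : Tendsto (fun t => distErr d (G.fullPos a (p t))) atTop (𝓝 0))
    (hF : ∀ t, 0 ≤ t → ‖G.errForce a d (p t)‖ ≤ A * Real.exp (-(r * t)))
    {c : Stacked V} (hc : Tendsto (fun t => rigidPart (p t)) atTop (𝓝 c))
    {q : Stacked (V ⊕ W)} (hq : ∀ k, ‖block (G.fullPos a q) k‖ = d k)
    {φ : ℝ} {τ : EuclideanSpace ℝ (Fin 2)}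
    (hcq : ∀ i, block c i =
      rotate (rot φ : Matrix (Fin 2) (Fin 2) ℝ) (block q (Sum.inl i)) + τ) :
    G.ConvergesToAmbit a d q p := by
  have hFlim : Tendsto (fun t => G.errForce a d (p t)) atTop (𝓝 0) := by
    rw [tendsto_zero_iff_norm_tendsto_zero]
    exact squeeze_zero' (Eventually.of_forall fun t => norm_nonneg _)
      ((eventually_ge_atTop 0).mono hF) (tendsto_mul_exp_neg hr A)
  have hblock : ∀ i, Tendsto (fun t => block (G.errForce a d (p t)) i) atTop (𝓝 0) := fun i =>
    ((continuous_block i).tendsto 0).comp hFlim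
  have hpd : ∀ t, 0 < t → HasDerivAt p (G.closedLoop a d (p t)) t := fun t ht =>
    (hp t ht.le).hasDerivAt (Ici_mem_nhds ht)
  -- The spin cancels exactly, leaving only error forces in the defect from uniform rotation.
  have hrel : ∀ t s, block (G.fullPos a (G.closedLoop a d (p t))) (Sum.inr s) -
      cw (block (G.fullPos a (p t)) (Sum.inr s)) =
      -block (G.errForce a d (p t)) (Sum.inr s) +
        block (G.errForce a d (p t)) (Sum.inl (a s)) := fun t s => by
    rw [block_relPos_inr, block_closedLoop_inr, block_closedLoop_inl, block_force_inr]
    abel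
  have hcorbit : G.relPos c ∈ orbit (G.relPos (rigidPart q)) := by
    refine mem_orbit.2 ⟨φ, fun k => ?_⟩
    rw [block_relPos, block_relPos, hcq, hcq, rotate_sub]
    exact add_sub_add_right_eq_sub _ _ _
  refine ⟨?_, rot φ, τ, fun i => ⟨?_, ?_⟩, fun s => ⟨?_, ?_⟩⟩
  · set K := orbit (G.relPos (rigidPart q)) with hK
    have hdev : Tendsto (fun t => deviation d K (G.fullPos a (p t))) atTop (𝓝 0) := by
      have h1 : Tendsto (fun t => Metric.infDist (rigidPart (G.fullPos a (p t))) K) atTop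
          (𝓝 0) := by
        simp only [rigidPart_relPos]
        rw [← Metric.infDist_zero_of_mem hcorbit]
        exact ((Metric.continuous_infDist_pt K).tendsto _).comp
          ((G.continuous_relPos.tendsto c).comp hc)
      have h2 := h1.max he.norm
      rwa [norm_zero, max_self] at h2
    refine Metric.tendsto_atTop'.2 fun ε hε => ?_
    obtain ⟨b, hb, h⟩ := exists_infDist_lt_of_deviation hd (isCompact_orbit _)
      ⟨_, self_mem_orbit _⟩ (G.satelliteCircles_subset_ambit a fun s => hq (Sum.inr s)) hε
    obtain ⟨N, hN⟩ := eventually_atTop.1 (hdev.eventually_le_const hb)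
    refine ⟨N, fun t ht => ?_⟩
    rw [Real.dist_eq, sub_zero, abs_of_nonneg Metric.infDist_nonneg]
    exact h _ (hN t ht.le)
  · beta_reduce
    rw [← hcq]
    exact ((continuous_block i).tendsto c).comp hc
  · have := (hblock (Sum.inl i)).neg
    rw [neg_zero] at this
    refine this.congr' ?_
    filter_upwards [eventually_gt_atTop 0] with t ht
    have h := (blockₗ (Sum.inl i)).comp_hasDerivWithinAt (hpd t ht).hasDerivWithinAt (s := Set.univ)
    rw [hasDerivWithinAt_univ] at h
    exact ((G.block_closedLoop_inl a d (p t) i).symm.trans h.deriv.symm)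
  · have hz : ∀ t, 0 ≤ t → HasDerivWithinAt (fun u => block (G.fullPos a (p u)) (Sum.inr s))
        (block (G.fullPos a (G.closedLoop a d (p t))) (Sum.inr s)) (Set.Ici 0) t := fun t ht =>
      (blockₗ (Sum.inr s) ∘ₗ (G.withSatellites a).relPosₗ).comp_hasDerivWithinAt (hp t ht)
    have hnorm : Tendsto (fun t => ‖block (G.fullPos a (p t)) (Sum.inr s)‖) atTop
        (𝓝 (d (Sum.inr s))) := by
      have h1 : Tendsto (fun t => distErr d (G.fullPos a (p t)) (Sum.inr s)) atTop (𝓝 0) :=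
        ((EuclideanSpace.proj (𝕜 := ℝ) (Sum.inr s)).continuous.tendsto 0).comp he
      have h2 := (Real.continuous_sqrt.tendsto _).comp (h1.add_const (d (Sum.inr s) ^ 2))
      rw [zero_add, Real.sqrt_sq (hd _).le] at h2
      refine h2.congr fun t => ?_
      simp only [Function.comp_apply, distErr_apply, sub_add_cancel]
      exact Real.sqrt_sq (norm_nonneg _)
    -- One `A` for the force on the satellite and one for the force on its neighbour.
    obtain ⟨θ, hθ⟩ := exists_phase (A := A + A) hr (by positivity) hz (fun t ht => by
      rw [hrel, add_mul]
      refine (norm_add_le _ _).trans (add_le_add ?_ ?_)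
      · rw [norm_neg]
        exact (norm_block_le _ _).trans (hF t ht)
      · exact (norm_block_le _ _).trans (hF t ht)) (hd (Sum.inr s)).le hnorm
    refine ⟨θ, ?_⟩
    have h1 := (((continuous_block (a s)).tendsto c).comp hc).sub_const (block c (a s))
    rw [sub_self] at h1
    have h2 := h1.add hθ
    rw [add_zero] at h2
    refine h2.congr fun t => ?_
    beta_reduce
    rw [← hcq, Function.comp_apply, block_rigidPart, block_relPos_inr]
    abel
  · have := (hblock (Sum.inr s)).neg.add (hblock (Sum.inl (a s)))
    rw [neg_zero, add_zero] at this
    refine this.congr' ?_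
    filter_upwards [eventually_gt_atTop 0] with t ht
    have h := (blockₗ (Sum.inr s) ∘ₗ (G.withSatellites a).relPosₗ).comp_hasDerivWithinAt
      (hpd t ht).hasDerivWithinAt (s := Set.univ)
    rw [hasDerivWithinAt_univ] at h
    rw [← hrel]
    exact congrArg (· - cw (block (G.fullPos a (p t)) (Sum.inr s))) h.deriv.symm

/-- Local exponential convergence near a compact set of shapes with independent rows. -/
theorem exists_forall_convergence (hcard : Fintype.card E + 3 = 2 * Fintype.card V)
    (hd : ∀ k, 0 < d k) {K : Set (Stacked E)} (hK : IsCompact K) (hne : K.Nonempty)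
    (hKr : K ⊆ Set.range G.relPos) (hKd : ∀ z ∈ K, ∀ k, ‖block z k‖ = d (Sum.inl k))
    (hI : ∀ z ∈ K, G.IndepAt z) :
    ∃ δ > 0, ∃ r > 0, ∀ p₀ : Stacked (V ⊕ W), deviation d K (G.fullPos a p₀) < δ →
      (∃ p, G.IsSolution a d p₀ p) ∧ ∀ p, G.IsSolution a d p₀ p → G.ErrorsDecay a d 1 r p ∧
        ∃ c : Stacked V, (∃ z ∈ K, G.relPos c ∈ orbit z) ∧
          ∀ (q : Stacked (V ⊕ W)) (φ : ℝ) (τ : EuclideanSpace ℝ (Fin 2)),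
            (∀ k, ‖block (G.fullPos a q) k‖ = d k) →
            (∀ i, block c i =
              rotate (rot φ : Matrix (Fin 2) (Fin 2) ℝ) (block q (Sum.inl i)) + τ) →
            G.ConvergesToAmbit a d q p := by
  obtain ⟨b, hb, r, hr, M, hM, htrap⟩ := G.exists_trapping a hd hK hne hI
  obtain ⟨b', hb', hloc⟩ := exists_forall_mem_orbit hcard hK hne hKr hI
  -- A strict bound weakens to `≤` in the limit; halving `b'` leaves the limit shape strictly within
  -- the range of local uniqueness.
  obtain ⟨δ, hδ, h⟩ := htrap (min b (b' / 2)) (lt_min hb (half_pos hb')) (min_le_left _ _)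
  refine ⟨δ, hδ, r, hr, fun p₀ hp₀ => ⟨?_, ?_⟩⟩
  · refine G.exists_solution_of_trapping a (K := K) (b := b) fun p hpc hp0 hp t ht => ?_
    obtain ⟨h1, h2, -, -⟩ := h p hpc (by rwa [hp0]) hp t ht
    exact ⟨h1.trans_le (min_le_left _ _), h2.trans_le (min_le_left _ _)⟩
  · rintro p ⟨hp0, hp⟩
    have hall := h p (fun t ht => (hp t ht).continuousWithinAt) (by rwa [hp0])
      fun t ht _ _ => hp t ht
    have hA : 0 ≤ M * ‖distErr d (G.fullPos a (p 0))‖ := by positivity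
    have hF := fun t ht => (hall t ht).2.2.2
    obtain ⟨c, hc⟩ := exists_tendsto_rigidPart hr hA hp hF
    have he : Tendsto (fun t => distErr d (G.fullPos a (p t))) atTop (𝓝 0) := by
      rw [tendsto_zero_iff_norm_tendsto_zero]
      exact squeeze_zero' (Eventually.of_forall fun t => norm_nonneg _)
        ((eventually_ge_atTop 0).mono fun t ht => (hall t ht).2.2.1) (tendsto_mul_exp_neg hr _)
    refine ⟨fun t ht => ?_, c, ?_, fun q φ τ hq hcq =>
      convergesToAmbit_of_tendsto hd hr hA hp he hF hc hq hcq⟩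
    · rw [one_mul]
      exact (hall t ht).2.2.1
    · have hrelc : Tendsto (fun t => rigidPart (G.fullPos a (p t))) atTop (𝓝 (G.relPos c)) := by
        simp only [rigidPart_relPos]
        exact (G.continuous_relPos.tendsto c).comp hc
      have hdist : Metric.infDist (G.relPos c) K ≤ b' / 2 :=
        le_of_tendsto (((Metric.continuous_infDist_pt K).tendsto _).comp hrelc)
          ((eventually_ge_atTop 0).mono fun t ht =>
            ((le_max_left _ _).trans (hall t ht).1.le).trans (min_le_right _ _))
      obtain ⟨z, hz, hzd⟩ := (Metric.infDist_lt_iff hne).1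
        (lt_of_le_of_lt hdist (half_lt_self hb'))
      refine ⟨z, hz, hloc _ ⟨c, rfl⟩ z hz hzd fun k => ?_⟩
      have h1 : Tendsto (fun t => distErr d (G.fullPos a (p t)) (Sum.inl k)) atTop
          (𝓝 (‖block (G.relPos c) k‖ ^ 2 - d (Sum.inl k) ^ 2)) :=
        ((((continuous_block k).norm.pow 2).tendsto _).comp hrelc).sub_const _
      have h2 : Tendsto (fun t => distErr d (G.fullPos a (p t)) (Sum.inl k)) atTop (𝓝 0) :=
        ((EuclideanSpace.proj (𝕜 := ℝ) (Sum.inl k)).continuous.tendsto 0).comp he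
      have h3 := sub_eq_zero.1 (tendsto_nhds_unique h1 h2)
      rw [hKd z hz]
      exact (pow_left_inj₀ (norm_nonneg _) (hd _).le two_ne_zero).1 h3

/-- Stability of a compact set of shapes with independent rows, and of the rigid agents. -/
theorem exists_forall_stability (hd : ∀ k, 0 < d k) {K : Set (Stacked E)} (hK : IsCompact K)
    (hne : K.Nonempty) (hI : ∀ z ∈ K, G.IndepAt z) {ε : ℝ} (hε : 0 < ε) :
    ∃ δ > 0, ∀ p₀ : Stacked (V ⊕ W), deviation d K (G.fullPos a p₀) < δ →
      ∀ p, G.IsSolution a d p₀ p → ∀ t, 0 ≤ t →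
        deviation d K (G.fullPos a (p t)) < ε ∧ ‖rigidPart (p t) - rigidPart p₀‖ < ε := by
  obtain ⟨b, hb, r, hr, M, hM, htrap⟩ := G.exists_trapping a hd hK hne hI
  obtain ⟨δ, hδ, h⟩ := htrap (min b ε) (lt_min hb hε) (min_le_left _ _)
  refine ⟨δ, hδ, fun p₀ hp₀ p ⟨hp0, hp⟩ t ht => ?_⟩
  obtain ⟨h1, h2, -, -⟩ := h p (fun t ht => (hp t ht).continuousWithinAt) (by rwa [hp0])
    (fun t ht _ _ => hp t ht) t ht
  rw [hp0] at h2
  exact ⟨h1.trans_le (min_le_right _ _), h2.trans_le (min_le_right _ _)⟩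

/-- The relative positions of the rigid agents that realize the prescribed distances. -/
def realizations (G : OrientedGraph V E) (d : E ⊕ W → ℝ) : Set (Stacked E) :=
  {z | z ∈ Set.range G.relPos ∧ ∀ k, ‖block z k‖ = d (Sum.inl k)}

theorem isClosed_range_relPos (G : OrientedGraph V E) : IsClosed (Set.range G.relPos) := by
  have : Set.range G.relPos = (LinearMap.range G.relPosₗ : Set (Stacked E)) := rfl
  rw [this]
  exact Submodule.closed_of_finiteDimensional _

theorem isCompact_realizations (G : OrientedGraph V E) (d : E ⊕ W → ℝ) :
    IsCompact (G.realizations d) := by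
  refine Metric.isCompact_of_isClosed_isBounded ?_ ?_
  · have : IsClosed (⋂ k, {z : Stacked E | ‖block z k‖ = d (Sum.inl k)}) :=
      isClosed_iInter fun k => isClosed_eq (continuous_block k).norm continuous_const
    have hset : G.realizations d =
        Set.range G.relPos ∩ ⋂ k, {z : Stacked E | ‖block z k‖ = d (Sum.inl k)} := by
      ext z
      simp [realizations]
    rw [hset]
    exact G.isClosed_range_relPos.inter this
  · refine (isBounded_norm_distErr_le (fun k => d (Sum.inl k)) 0).subset fun z hz => ?_
    have : distErr (fun k => d (Sum.inl k)) z = 0 := by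
      ext k
      simp [distErr_apply, hz.2 k]
    simp [this]

/-- Small errors force closeness to `realizations` only among vectors that come from a placement.
Compactness is therefore applied to the errors together with the distance to the range of the
relative positions, which is zero at an actual placement. -/
theorem exists_deviation_lt_of_norm_distErr (hd : ∀ k, 0 < d k)
    (hne : (G.realizations d).Nonempty) {ε : ℝ} (hε : 0 < ε) :
    ∃ b > 0, ∀ p : Stacked (V ⊕ W), ‖distErr d (G.fullPos a p)‖ < b →
      deviation d (G.realizations d) (G.fullPos a p) < ε := by
  have hK := G.isCompact_realizations d
  set R : Set (Stacked (E ⊕ W)) := Set.range (G.withSatellites a).relPos with hR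
  have hRc : IsClosed R := isClosed_range_relPos _
  have hc : Continuous fun z : Stacked (E ⊕ W) => max (Metric.infDist z R) ‖distErr d z‖ :=
    (Metric.continuous_infDist_pt R).max (continuous_distErr d).norm
  obtain ⟨b, hb, -, h⟩ := exists_sublevel_subset hc
    (Metric.isCompact_of_isClosed_isBounded (isClosed_le hc continuous_const)
      ((isBounded_norm_distErr_le d 1).subset fun z
        (hz : max (Metric.infDist z R) ‖distErr d z‖ ≤ 1) =>
        show ‖distErr d z‖ ≤ 1 from (le_max_right _ _).trans hz))
    (isOpen_lt (continuous_deviation d (G.realizations d)) (continuous_const (y := ε)))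
    (fun z hz => by
      obtain ⟨h1, h2⟩ := max_le_iff.1 (show max (Metric.infDist z R) ‖distErr d z‖ ≤ 0 from hz)
      have hzR : z ∈ R := (hRc.mem_iff_infDist_zero ⟨_, 0, rfl⟩).2
        (le_antisymm h1 Metric.infDist_nonneg)
      have hzd := (distErr_eq_zero_iff hd).1 (norm_le_zero_iff.1 h2)
      obtain ⟨p, rfl⟩ := hzR
      refine lt_of_le_of_lt ((deviation_le_zero_iff hd hK hne).2 ⟨⟨?_, fun k => ?_⟩, hzd⟩) hε
      · exact ⟨rigidPart p, (G.rigidPart_relPos a p).symm⟩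
      · exact hzd (Sum.inl k))
  refine ⟨b, hb, fun p hp => h ?_⟩
  have hpR : G.fullPos a p ∈ R := ⟨p, rfl⟩
  exact max_le ((Metric.infDist_zero_of_mem hpR).trans_le hb.le) hp.le

end OrientedGraph

/-! ### Assembly of the theorem -/

open OrientedGraph in
theorem theorem2 {n m l : ℕ} (G : OrientedGraph (Fin n) (Fin l)) (a : Fin m → Fin n)
    (pstar : Stacked (Fin n ⊕ Fin m)) (d : Fin l ⊕ Fin m → ℝ)
    (hd : ∀ k, 0 < d k)
    (hdes : ∀ k, ‖block ((G.withSatellites a).relPos pstar) k‖ = d k)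
    (hrigid : G.MinInfRigid (OrientedGraph.rigidPart pstar)) :
    -- local exponential convergence of the errors, and convergence to the desired ambit
    (∃ δ > 0, ∃ C > 0, ∃ r > 0, ∀ p₀ : Stacked (Fin n ⊕ Fin m),
      Metric.infDist ((G.withSatellites a).relPos p₀) ((G.withSatellites a).ambit pstar) < δ →
      (∃ p, G.IsSolution a d p₀ p) ∧
      ∀ p, G.IsSolution a d p₀ p → G.ErrorsDecay a d C r p ∧ G.ConvergesToAmbit a d pstar p) ∧
    -- stability of the desired ambit, and of the placement of the rigid agents in the plane
    (∀ ε > 0, ∃ δ > 0, ∀ p₀ : Stacked (Fin n ⊕ Fin m),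
      Metric.infDist ((G.withSatellites a).relPos p₀) ((G.withSatellites a).ambit pstar) < δ →
      ∀ p, G.IsSolution a d p₀ p → ∀ t, 0 ≤ t →
        Metric.infDist ((G.withSatellites a).relPos (p t)) ((G.withSatellites a).ambit pstar) < ε ∧
        ∀ i : Fin n, ‖block (p t) (Sum.inl i) - block p₀ (Sum.inl i)‖ < ε) ∧
    -- a small initial error suffices if the prescribed distances force infinitesimal rigidity
    ((∀ q : Stacked (Fin n), (∀ k, ‖block (G.relPos q) k‖ = d (Sum.inl k)) → G.InfRigid q) →
      ∃ δ > 0, ∃ C > 0, ∃ r > 0, ∀ p₀ : Stacked (Fin n ⊕ Fin m),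
        ‖distErr d ((G.withSatellites a).relPos p₀)‖ < δ →
        (∃ p, G.IsSolution a d p₀ p) ∧
        ∀ p, G.IsSolution a d p₀ p → G.ErrorsDecay a d C r p ∧
          ∃ q : Stacked (Fin n ⊕ Fin m),
            (∀ k, ‖block ((G.withSatellites a).relPos q) k‖ = d k) ∧
            G.ConvergesToAmbit a d q p) := by
  have hcard := hrigid.card_eq
  have hI := (indepAt_iff_infRigid hcard (rigidPart pstar)).2 hrigid.1
  set K := orbit (G.relPos (rigidPart pstar)) with hKdef
  have hK : IsCompact K := isCompact_orbit _
  have hne : K.Nonempty := ⟨_, self_mem_orbit _⟩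
  have hzd : ∀ k, ‖block (G.relPos (rigidPart pstar)) k‖ = d (Sum.inl k) := fun k => by
    rw [← G.rigidPart_relPos a, block_rigidPart, hdes]
  have hKd : ∀ z ∈ K, ∀ k, ‖block z k‖ = d (Sum.inl k) := fun z hz k => by
    rw [norm_block_of_mem_orbit hz, hzd]
  have hKI : ∀ z ∈ K, G.IndepAt z := fun z hz => hI.of_mem_orbit hz
  have hambit : (G.withSatellites a).ambit pstar = satelliteCircles d K :=
    (ambit_subset_satelliteCircles hcard hI fun s => hdes _).antisymm
      (G.satelliteCircles_subset_ambit a fun s => hdes _)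
  have hAne : (satelliteCircles d K).Nonempty :=
    ⟨(G.withSatellites a).relPos pstar, by
      rw [rigidPart_relPos]
      exact self_mem_orbit _, fun s => hdes _⟩
  rw [hambit]
  refine ⟨?_, fun ε hε => ?_, fun hall => ?_⟩
  · obtain ⟨δ, hδ, r, hr, h⟩ := exists_forall_convergence (a := a) hcard hd hK hne
      (G.orbit_relPos_subset_range _) hKd hKI
    obtain ⟨δ', hδ', h'⟩ := exists_deviation_lt_of_infDist hd hK hne hKd hAne hδ
    refine ⟨δ', hδ', 1, one_pos, r, hr, fun p₀ hp₀ => ?_⟩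
    obtain ⟨hex, hsol⟩ := h p₀ (h' _ hp₀)
    refine ⟨hex, fun p hp => ?_⟩
    obtain ⟨hdecay, c, ⟨z, hz, hcz⟩, hconv⟩ := hsol p hp
    refine ⟨hdecay, ?_⟩
    obtain ⟨φ, hφ⟩ := mem_orbit.1 (orbit_trans hcz hz)
    -- The limit `c` and the rotated placement have equal relative positions, so they differ by a
    -- translation.
    have hrelc : G.relPos (c - rotatePlacement φ (rigidPart pstar)) = 0 := by
      rw [relPos_sub, sub_eq_zero]
      exact stacked_ext fun k => by rw [hφ, block_relPos_rotatePlacement]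
    obtain ⟨τ, hτ⟩ := hI.exists_block_eq_of_relPos_eq_zero hcard hrelc
    refine hconv pstar φ τ hdes fun i => ?_
    rw [← hτ i, block_sub, add_comm]
    exact (sub_add_cancel _ _).symm
  · obtain ⟨b, hb, hbA⟩ := exists_infDist_lt_of_deviation hd hK hne
      (subset_refl (satelliteCircles d K)) hε
    obtain ⟨δ, hδ, h⟩ := exists_forall_stability (a := a) hd hK hne hKI (lt_min hb hε)
    obtain ⟨δ', hδ', h'⟩ := exists_deviation_lt_of_infDist hd hK hne hKd hAne hδ
    refine ⟨δ', hδ', fun p₀ hp₀ p hp t ht => ?_⟩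
    obtain ⟨h1, h2⟩ := h p₀ (h' _ hp₀) p hp t ht
    exact ⟨hbA _ (h1.le.trans (min_le_left _ _)), fun i =>
      ((norm_block_le (rigidPart (p t) - rigidPart p₀) i).trans_lt h2).trans_le (min_le_right _ _)⟩
  · have hKne : (G.realizations d).Nonempty := ⟨_, ⟨_, rfl⟩, hzd⟩
    obtain ⟨δ, hδ, r, hr, h⟩ := exists_forall_convergence (a := a) hcard hd
      (G.isCompact_realizations d) hKne (fun z hz => hz.1) (fun z hz => hz.2) (by
        rintro _ ⟨⟨q, rfl⟩, hq⟩
        exact (indepAt_iff_infRigid hcard q).2 (hall q hq))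
    obtain ⟨δ', hδ', h'⟩ := exists_deviation_lt_of_norm_distErr (a := a) hd hKne hδ
    refine ⟨δ', hδ', 1, one_pos, r, hr, fun p₀ hp₀ => ?_⟩
    obtain ⟨hex, hsol⟩ := h p₀ (h' _ hp₀)
    refine ⟨hex, fun p hp => ?_⟩
    obtain ⟨hdecay, c, ⟨z, hz, hcz⟩, hconv⟩ := hsol p hp
    -- The limit of the rigid agents becomes the rigid part of `q`, so neither rotation nor
    -- translation is needed. The direction of the satellites is arbitrary, as the ambit contains
    -- all of them.
    have hq : ∀ k, ‖block ((G.withSatellites a).relPos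
        (attach a c fun s => !₂[d (Sum.inr s), 0])) k‖ = d k := by
      rintro (k | s)
      · rw [← block_rigidPart, rigidPart_relPos, rigidPart_attach, norm_block_of_mem_orbit hcz,
          hz.2]
      · rw [block_relPos_attach_inr, EuclideanSpace.norm_eq]
        simp [Fin.sum_univ_two, Real.sqrt_sq (hd (Sum.inr s)).le]
    refine ⟨hdecay, _, hq, hconv _ 0 0 hq fun i => ?_⟩
    rw [rot_zero, add_zero]
    exact (rotate_one _).symm
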